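/- Let $m,n\ge 0$ be integers, $\overline\varrho\ge 1$, $\sigma\ge 0$, $\varkappa\ge0$, $0<\alpha\le 1$. Write $\|u\|_{n,2}=(\sum_{t=0}^n|u_t|^2)^{1/2}$ for $u\in\mathbb C^{\mathbb Z}$, $[\Delta u]_t=u_{t-1}$, $[u*v]_t=\sum_{\tau\in\mathbb Z}u_\tau v_{t-\tau}$, and let $\|u\|^*_{m,1}=\sum_{k=0}^{m}\big|(m+1)^{-1/2}\sum_{t=0}^m u_t e^{2\pi i kt/(m+1)}\big|$ be the $\ell_1$-norm of the unitary discrete Fourier transform of $(u_0,\dots,u_m)$. Let $y_t=x_t+\sigma\zeta_t$, where $\zeta_t$, $-m\le t\le n$, are independent, $\zeta_t=\xi_t^1+i\xi_t^2$ with independent $\xi_t^1,\xi_t^2\sim\mathcal N(0,1)$. Suppose that the signal $x\in\mathbb C^{\mathbb Z}$ is close to a shift-invariant subspace: $x=x^{\mathcal S}+\varepsilon$, where $x^{\mathcal S}\in\mathcal S$ for an (unknown) complex linear subspace $\mathcal S\subset\mathbb C^{\mathbb Z}$ with $\Delta\mathcal S\subseteq\mathcal S$ and $\dim\mathcal S=s$,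 $1\le s\le n+1$, and $\|\Delta^\tau\varepsilon\|_{n,2}\le\sigma\varkappa$ for $0\le\tau\le m$. Call $\varphi\in\mathbb C^{\mathbb Z}$ feasible if $\varphi_t=0$ for $t\notin[0,m]$ and $\|\varphi\|^*_{m,1}\le\overline\varrho/\sqrt{m+1}$. Put $$\kappa_{m,n}=\sqrt{\tfrac{n+1}{m+1}},\qquad c_\alpha=\sqrt{2\ln[16/\alpha]},\qquad V_\alpha=2(1+4\kappa_{m,n})^2\ln[55(m+n+1)/\alpha].$$ Then there is an absolute constant $C>0$ such that, for every feasible $\varphi$, there is a set $\Xi_\alpha$ of realizations of the noise with $\mathbb P\{\zeta\in\Xi_\alpha\}\ge1-\alpha$ for which, whenever $\zeta\in\Xi_\alpha$, every minimizer $\widehat\varphi$ of $\|y-\psi*y\|_{n,2}^2$ over all feasible $\psi$ satisfies the following. (i) $$\|x-\widehat\varphi*y\|_{n,2}\le\|x-\varphi*y\|_{n,2}+2\sigma\Big[\sqrt{\overline\varrho V_\alpha}+\sqrt{(\overline\varrho+1)c_\alpha\varkappa}+\sqrt{2s}+c_\alpha\Big].$$ (ii) If $m,n\ge1$, then $\|x-\widehat\varphi*y\|_{n,2}\le\|x-\varphi*y\|_{n,2}+C\sigma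 \tilde r_0^{1/2}$ with $$\tilde r_0=\overline\varrho(1+\kappa_{m,n}^2)\ln[(m+n)/\alpha]+\overline\varrho\varkappa\sqrt{\ln[2/\alpha]}+s.$$ (iii) If $1\le m\le n$ and $\alpha\le 1/2$, then $\|x-\widehat\varphi*y\|_{n,2}\le\|x-\varphi*y\|_{n,2}+C\sigma r_0^{1/2}$ with $$r_0=\overline\varrho\kappa_{m,n}^2\ln[(m+n)/\alpha]+\overline\varrho\varkappa\sqrt{\ln[1/\alpha]}+s.$$ -/

import Mathlib

open MeasureTheory ProbabilityTheory

noncomputable section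

namespace FilterLS

/-- The right shift `[Δ x]_t = x_{t-1}` on two-sided complex sequences. -/
def shift : (ℤ → ℂ) →ₗ[ℂ] (ℤ → ℂ) where
  toFun x := fun t => x (t - 1)
  map_add' _ _ := rfl
  map_smul' _ _ := rfl

/-- The convolution `[u * v]_t = ∑_τ u_τ v_{t-τ}` (it is used for finitely supported `u`). -/
def conv (u v : ℤ → ℂ) : ℤ → ℂ := fun t => ∑' τ : ℤ, u τ * v (t - τ)

/-- The Euclidean norm of the restriction of `x` to `[0, n]`. -/
def l2norm (n : ℕ) (x : ℤ → ℂ) : ℝ :=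
  Real.sqrt (∑ t ∈ Finset.range (n + 1), ‖x (t : ℤ)‖ ^ 2)

/-- The `k`-th coefficient of the unitary discrete Fourier transform of `(x_0, …, x_n)`. -/
def dft (n : ℕ) (x : ℤ → ℂ) (k : ℕ) : ℂ :=
  ((Real.sqrt ((n : ℝ) + 1))⁻¹ : ℝ) * ∑ t ∈ Finset.range (n + 1),
    x (t : ℤ) * Complex.exp (2 * Real.pi * Complex.I * k * t / ((n : ℂ) + 1))

/-- The `ℓ₁`-norm of the unitary discrete Fourier transform of `(x_0, …, x_n)`. -/
def fourierL1 (n : ℕ) (x : ℤ → ℂ) : ℝ :=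
  ∑ k ∈ Finset.range (n + 1), ‖dft n x k‖

/-- The filters supported on `[0, m]` whose Fourier `ℓ₁`-norm is at most `ρ / √(m+1)`. -/
def feasible (m : ℕ) (ρ : ℝ) : Set (ℤ → ℂ) :=
  {φ | (∀ t : ℤ, t ∉ Set.Icc (0 : ℤ) m → φ t = 0) ∧
    fourierL1 m φ ≤ ρ / Real.sqrt ((m : ℝ) + 1)}

/-- `φ` is an optimal solution of the constrained least-squares problem
`min {‖y - φ * y‖²_{n,2} : φ ∈ feasible m ρ}`. -/
def IsConstrainedLS (m n : ℕ) (ρ : ℝ) (y φ : ℤ → ℂ) : Prop :=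
  φ ∈ feasible m ρ ∧ ∀ ψ ∈ feasible m ρ, l2norm n (y - conv φ y) ^ 2 ≤ l2norm n (y - conv ψ y) ^ 2

/-- The signal `x` is `ℓ₂`-close, at level `σ ϰ`, to a shift-invariant subspace of
dimension `s`, where `1 ≤ s ≤ n + 1`. -/
def NearShiftInvariant (m n s : ℕ) (σ ϰ : ℝ) (x : ℤ → ℂ) : Prop :=
  1 ≤ s ∧ s ≤ n + 1 ∧
    ∃ S : Submodule ℂ (ℤ → ℂ), Module.finrank ℂ S = s ∧ (∀ u ∈ S, shift u ∈ S) ∧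
      ∃ xS ∈ S, ∃ ε : ℤ → ℂ, x = xS + ε ∧
        ∀ τ : ℕ, τ ≤ m → l2norm n ((shift ^ τ) ε) ≤ σ * ϰ

/-- The variables `ζ_t`, `t ∈ I`, are independent, and each is `ξ₁ + i ξ₂` with independent
standard real Gaussian `ξ₁`, `ξ₂`. -/
structure IsComplexWhiteNoise {Ω : Type*} [MeasurableSpace Ω] (μ : Measure Ω) (I : Set ℤ)
    (ζ : ℤ → Ω → ℂ) : Prop where
  measurable : ∀ t ∈ I, Measurable (ζ t)
  law : ∀ t ∈ I, μ.map (fun ω => ((ζ t ω).re, (ζ t ω).im)) =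
    (gaussianReal 0 1).prod (gaussianReal 0 1)
  indep : iIndepFun (fun (t : I) => ζ t) μ

/-- The observations `y_t = x_t + σ z_t`. -/
def observe (x : ℤ → ℂ) (σ : ℝ) (z : ℤ → ℂ) : ℤ → ℂ := fun t => x t + σ * z t

/-- `κ_{m,n} = √((n+1)/(m+1))`. -/
def kappa (m n : ℕ) : ℝ := Real.sqrt (((n : ℝ) + 1) / ((m : ℝ) + 1))

/-- `c_α = √(2 ln(16/α))`. -/
def cAlpha (α : ℝ) : ℝ := Real.sqrt (2 * Real.log (16 / α))

/-- `V_α = 2 (1 + 4 κ)² ln(55 (m+n+1)/α)`. -/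
def vAlpha (m n : ℕ) (α : ℝ) : ℝ :=
  2 * (1 + 4 * kappa m n) ^ 2 * Real.log (55 * ((m : ℝ) + n + 1) / α)

/-- The remainder `ρ κ² ln((m+n)/α) + ρ ϰ √(ln(1/α)) + s`. -/
def r0 (m n s : ℕ) (ρ ϰ α : ℝ) : ℝ :=
  ρ * kappa m n ^ 2 * Real.log (((m : ℝ) + n) / α) + ρ * ϰ * Real.sqrt (Real.log (1 / α)) + s

/-- The remainder `ρ (1 + κ²) ln((m+n)/α) + ρ ϰ √(ln(2/α)) + s`. -/
def r0Uniform (m n s : ℕ) (ρ ϰ α : ℝ) : ℝ :=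
  ρ * (1 + kappa m n ^ 2) * Real.log (((m : ℝ) + n) / α)
    + ρ * ϰ * Real.sqrt (Real.log (2 / α)) + s

end FilterLS

end

/-
Comparing the minimizer with `φ` in the least-squares criterion bounds the squared residual by that
of `φ` plus a cross term between the noise and the difference of the two residuals. The part of the
cross term in the image of `𝒮` involves only the projection of the noise onto an `s`-dimensional
space. On its orthogonal complement, shift invariance removes `x^𝒮`, leaving linear and quadratic
forms in the noise. Feasible filters are `ρ` times an absolutely convex combination of the `m + 1`
filters with a single Fourier coefficient, so it suffices to control these forms for those filters.
The quadratic forms have Hilbert–Schmidt norm at most `κ`. Their traces are bounded through the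
frequency responses on the Fourier basis of `[-m, n]`, that is by sampled Dirichlet kernels, which
produces the logarithm.
-/

noncomputable section

namespace FilterLS

open scoped ENNReal

section ComplexGaussian

lemma lintegral_half_sq_eq {f : ℝ → ℝ≥0∞} :
    ∫⁻ r in Set.Ioi (0 : ℝ), ENNReal.ofReal r * f (r ^ 2 / 2) = ∫⁻ u in Set.Ioi (0 : ℝ), f u := by
  have hderiv : ∀ r ∈ Set.Ioi (0 : ℝ),
      HasDerivWithinAt (fun r : ℝ => r ^ 2 / 2) r (Set.Ioi 0) r := fun r _ =>
    (((hasDerivAt_pow 2 r).div_const 2).congr_deriv (by simp)).hasDerivWithinAt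
  have hmono : MonotoneOn (fun r : ℝ => r ^ 2 / 2) (Set.Ioi 0) := fun a ha b _ hab => by
    have : 0 < a := ha
    simp only
    gcongr
  have himage : (fun r : ℝ => r ^ 2 / 2) '' Set.Ioi 0 = Set.Ioi 0 := by
    ext u
    refine ⟨?_, fun hu => ⟨√(2 * u), Real.sqrt_pos.2 (mul_pos two_pos hu), ?_⟩⟩
    · rintro ⟨r, hr, rfl⟩
      have : 0 < r := hr
      exact Set.mem_Ioi.2 (by positivity)
    · simp only
      rw [Real.sq_sqrt (mul_pos two_pos hu).le, mul_div_cancel_left₀ u two_ne_zero]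
  rw [← lintegral_image_eq_lintegral_deriv_mul_of_monotoneOn measurableSet_Ioi hderiv hmono,
    himage]

lemma lintegral_comp_half_sq_norm {f : ℝ → ℝ≥0∞} (hf : Measurable f) :
    ∫⁻ z : ℂ, f (‖z‖ ^ 2 / 2) = ENNReal.ofReal (2 * Real.pi) * ∫⁻ u in Set.Ioi (0 : ℝ), f u := by
  have hpolar : ∀ p ∈ Set.Ioi (0 : ℝ) ×ˢ Set.Ioo (-Real.pi) Real.pi,
      ENNReal.ofReal p.1 • f (‖Complex.polarCoord.symm p‖ ^ 2 / 2)
        = ENNReal.ofReal p.1 * f (p.1 ^ 2 / 2) * 1 := fun p _ => by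
    rw [Complex.norm_polarCoord_symm, sq_abs, smul_eq_mul, mul_one]
  rw [← Complex.lintegral_comp_polarCoord_symm, polarCoord_target,
    setLIntegral_congr_fun (measurableSet_Ioi.prod measurableSet_Ioo) hpolar,
    Measure.volume_eq_prod, ← Measure.prod_restrict,
    lintegral_prod_mul (f := fun r => ENNReal.ofReal r * f (r ^ 2 / 2)) (g := fun _ => 1)
      (by fun_prop) aemeasurable_const,
    lintegral_half_sq_eq, lintegral_one, Measure.restrict_apply_univ, Real.volume_Ioo, mul_comm,
    sub_neg_eq_add, two_mul]

lemma map_prod_gaussianReal_eq_stdGaussian :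
    ((gaussianReal 0 1).prod (gaussianReal 0 1)).map Complex.measurableEquivRealProd.symm
      = stdGaussian ℂ := by
  rw [stdGaussian_eq_map_pi_orthonormalBasis Complex.orthonormalBasisOneI,
    ← (measurePreserving_finTwoArrow (gaussianReal 0 1)).map_eq,
    Measure.map_map (by fun_prop) (by fun_prop)]
  congr 1
  funext x
  apply Complex.ext <;> simp [Fin.sum_univ_two, MeasurableEquiv.finTwoArrow]

lemma stdGaussian_complex_eq_withDensity :
    stdGaussian ℂ = (volume : Measure ℂ).withDensity
      (fun z => ENNReal.ofReal ((2 * Real.pi)⁻¹ * Real.exp (-(‖z‖ ^ 2 / 2)))) := by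
  rw [← map_prod_gaussianReal_eq_stdGaussian, gaussianReal_of_var_ne_zero _ one_ne_zero,
    prod_withDensity (by fun_prop) (by fun_prop), ← Measure.volume_eq_prod,
    ← Complex.volume_preserving_equiv_real_prod.symm.map_eq]
  ext s hs
  rw [Measure.map_apply (by fun_prop) hs, withDensity_apply _ hs,
    withDensity_apply _ (Complex.measurableEquivRealProd.symm.measurable hs),
    Measure.restrict_map Complex.measurableEquivRealProd.symm.measurable hs,
    lintegral_map (by fun_prop) Complex.measurableEquivRealProd.symm.measurable]
  refine lintegral_congr fun p => ?_
  rw [gaussianPDF, gaussianPDF, ← ENNReal.ofReal_mul (gaussianPDFReal_nonneg _ _ _)]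
  congr 1
  simp only [gaussianPDFReal, NNReal.coe_one, mul_one, sub_zero]
  rw [mul_mul_mul_comm, ← Real.exp_add, ← mul_inv, Real.mul_self_sqrt (by positivity),
    Complex.sq_norm, Complex.normSq_apply, Complex.measurableEquivRealProd_symm_apply]
  congr 2
  ring

lemma lintegral_expMeasure {r : ℝ} {f : ℝ → ℝ≥0∞} (hf : Measurable f) :
    ∫⁻ u, f u ∂(expMeasure r)
      = ∫⁻ u in Set.Ioi (0 : ℝ), ENNReal.ofReal (r * Real.exp (-(r * u))) * f u := by
  have hpdf : Measurable (exponentialPDF r) := (measurable_exponentialPDFReal r).ennreal_ofReal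
  rw [show expMeasure r = volume.withDensity (exponentialPDF r) from rfl,
    lintegral_withDensity_eq_lintegral_mul _ hpdf hf, ← lintegral_indicator measurableSet_Ioi]
  refine lintegral_congr_ae ?_
  filter_upwards [Measure.ae_ne volume 0] with u hu
  rcases hu.lt_or_gt with hneg | hpos
  · simp [exponentialPDF_of_neg hneg, hneg.le]
  · simp [exponentialPDF_of_nonneg hpos.le, hpos]

lemma map_half_sq_norm_stdGaussian :
    (stdGaussian ℂ).map (fun z => ‖z‖ ^ 2 / 2) = expMeasure 1 := by
  refine Measure.ext_of_lintegral _ fun f hf => ?_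
  have h2π : ENNReal.ofReal (2 * Real.pi)⁻¹ * ENNReal.ofReal (2 * Real.pi) = 1 := by
    rw [← ENNReal.ofReal_mul (by positivity), inv_mul_cancel₀ (by positivity), ENNReal.ofReal_one]
  have hradial := lintegral_comp_half_sq_norm
    (f := fun u => ENNReal.ofReal (Real.exp (-u)) * f u) (by fun_prop)
  rw [lintegral_map hf (by fun_prop), stdGaussian_complex_eq_withDensity,
    lintegral_withDensity_eq_lintegral_mul _ (by fun_prop) (by fun_prop)]
  simp_rw [Pi.mul_apply, ENNReal.ofReal_mul (show 0 ≤ (2 * Real.pi)⁻¹ by positivity), mul_assoc]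
  rw [lintegral_const_mul _ (by fun_prop), hradial, ← mul_assoc, h2π, one_mul,
    lintegral_expMeasure hf]
  simp only [one_mul]

lemma stdGaussian_complex_sq_norm_tail {t : ℝ} (ht : 0 ≤ t) :
    stdGaussian ℂ {z | 2 * t < ‖z‖ ^ 2} = ENNReal.ofReal (Real.exp (-t)) := by
  have := isProbabilityMeasure_expMeasure one_pos
  have hpre : {z : ℂ | 2 * t < ‖z‖ ^ 2} = (fun z => ‖z‖ ^ 2 / 2) ⁻¹' (Set.Iic t)ᶜ := by
    ext z
    simp only [Set.mem_ofPred_eq, Set.compl_Iic, Set.mem_preimage, Set.mem_Ioi,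
      lt_div_iff₀' (zero_lt_two' ℝ)]
  rw [hpre, ← Measure.map_apply (by fun_prop) measurableSet_Iic.compl,
    map_half_sq_norm_stdGaussian, prob_compl_eq_one_sub measurableSet_Iic, ← ofReal_cdf,
    cdf_expMeasure_eq one_pos, if_pos ht, ← ENNReal.ofReal_one,
    ← ENNReal.ofReal_sub _ (by simp [ht])]
  simp

lemma lintegral_exp_mul_sq_norm_stdGaussian {x : ℝ} (hx : x < 1) :
    ∫⁻ z, ENNReal.ofReal (Real.exp (x * (‖z‖ ^ 2 / 2))) ∂(stdGaussian ℂ)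
      = ENNReal.ofReal (1 - x)⁻¹ := by
  have hx' : 0 < 1 - x := sub_pos.2 hx
  have := isProbabilityMeasure_expMeasure hx'
  have htilt : ∀ u : ℝ, ENNReal.ofReal (1 * Real.exp (-(1 * u))) * ENNReal.ofReal (Real.exp (x * u))
      = ENNReal.ofReal (1 - x)⁻¹ * (ENNReal.ofReal ((1 - x) * Real.exp (-((1 - x) * u))) * 1) := by
    intro u
    rw [mul_one, one_mul, ← ENNReal.ofReal_mul (Real.exp_pos _).le,
      ← ENNReal.ofReal_mul (inv_nonneg.2 hx'.le), ← Real.exp_add, inv_mul_cancel_left₀ hx'.ne']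
    congr 2
    ring
  rw [← lintegral_map (f := fun u => ENNReal.ofReal (Real.exp (x * u))) (by fun_prop)
      (by fun_prop : Measurable fun z : ℂ => ‖z‖ ^ 2 / 2),
    map_half_sq_norm_stdGaussian, lintegral_expMeasure (by fun_prop)]
  simp_rw [htilt]
  rw [lintegral_const_mul _ (by fun_prop), ← lintegral_expMeasure measurable_const, lintegral_one,
    measure_univ, mul_one]

lemma map_pi_stdGaussian_complex {ι : Type*} [Fintype ι] :
    (Measure.pi (fun _ : ι => stdGaussian ℂ)).map (WithLp.toLp 2)
      = stdGaussian (EuclideanSpace ℂ ι) := by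
  apply Measure.ext_of_charFun (E := EuclideanSpace ℂ ι)
  ext t
  simp_rw [charFun_stdGaussian, charFun_pi, charFun_stdGaussian, ← Complex.exp_sum,
    ← Complex.ofReal_pow, EuclideanSpace.norm_sq_eq]
  simp [Finset.sum_div, neg_div]

lemma IsComplexWhiteNoise.map_eq_stdGaussian {Ω : Type*} [MeasurableSpace Ω] {μ : Measure Ω}
    [IsProbabilityMeasure μ] {I : Set ℤ} [Fintype I] {ζ : ℤ → Ω → ℂ}
    (h : IsComplexWhiteNoise μ I ζ) :
    μ.map (fun ω => (WithLp.toLp 2 (fun t : I => ζ t ω) : EuclideanSpace ℂ I))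
      = stdGaussian (EuclideanSpace ℂ I) := by
  have hmeas : ∀ t : I, Measurable (ζ t) := fun t => h.measurable t t.2
  have hlaw : ∀ t : I, μ.map (ζ t) = stdGaussian ℂ := fun t => by
    have hp : Measurable fun ω => ((ζ t ω).re, (ζ t ω).im) := by fun_prop
    rw [← map_prod_gaussianReal_eq_stdGaussian, ← h.law t t.2, Measure.map_map (by fun_prop) hp]
    rfl
  have hprod := (iIndepFun_iff_map_fun_eq_pi_map fun t : I => (hmeas t).aemeasurable).1 h.indep
  simp_rw [hlaw] at hprod
  rw [← map_pi_stdGaussian_complex, ← hprod,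
    Measure.map_map (by fun_prop) (measurable_pi_lambda _ hmeas)]
  rfl

end ComplexGaussian

section HilbertSchmidt

open LinearMap

variable {E F G ι : Type*} [NormedAddCommGroup E] [InnerProductSpace ℂ E] [FiniteDimensional ℂ E]
  [NormedAddCommGroup F] [InnerProductSpace ℂ F] [FiniteDimensional ℂ F]
  [NormedAddCommGroup G] [InnerProductSpace ℂ G] [FiniteDimensional ℂ G] [Fintype ι]

/-- The squared Hilbert-Schmidt norm of a linear map between finite-dimensional inner product
spaces. It controls the fluctuations of Gaussian quadratic forms. -/
def hsNormSq (A : E →ₗ[ℂ] F) : ℝ := (trace ℂ E (adjoint A ∘ₗ A)).re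

lemma hsNormSq_eq_sum (b : OrthonormalBasis ι ℂ E) (A : E →ₗ[ℂ] F) :
    hsNormSq A = ∑ i, ‖A (b i)‖ ^ 2 := by
  rw [hsNormSq, trace_eq_sum_inner _ b, Complex.re_sum]
  refine Finset.sum_congr rfl fun i _ => ?_
  rw [comp_apply, adjoint_inner_right]
  exact inner_self_eq_norm_sq (𝕜 := ℂ) _

lemma hsNormSq_adjoint (A : E →ₗ[ℂ] F) : hsNormSq (adjoint A) = hsNormSq A := by
  rw [hsNormSq, hsNormSq, adjoint_adjoint, trace_comp_comm']

lemma hsNormSq_smul (c : ℂ) (A : E →ₗ[ℂ] F) : hsNormSq (c • A) = ‖c‖ ^ 2 * hsNormSq A := by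
  simp_rw [hsNormSq_eq_sum (stdOrthonormalBasis ℂ E), LinearMap.smul_apply, norm_smul, mul_pow,
    ← Finset.mul_sum]

lemma hsNormSq_add_le (A B : E →ₗ[ℂ] F) :
    hsNormSq (A + B) ≤ 2 * (hsNormSq A + hsNormSq B) := by
  simp_rw [hsNormSq_eq_sum (stdOrthonormalBasis ℂ E), ← Finset.sum_add_distrib, Finset.mul_sum]
  refine Finset.sum_le_sum fun i _ => ?_
  exact (pow_le_pow_left₀ (norm_nonneg _) (norm_add_le _ _) 2).trans add_sq_le

lemma hsNormSq_comp_le_right {B : F →ₗ[ℂ] G} (hB : ∀ y, ‖B y‖ ≤ ‖y‖) (A : E →ₗ[ℂ] F) :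
    hsNormSq (B ∘ₗ A) ≤ hsNormSq A := by
  simp_rw [hsNormSq_eq_sum (stdOrthonormalBasis ℂ E), comp_apply]
  exact Finset.sum_le_sum fun i _ => pow_le_pow_left₀ (norm_nonneg _) (hB _) 2

lemma norm_adjoint_apply_le {A : E →ₗ[ℂ] F} (hA : ∀ z, ‖A z‖ ≤ ‖z‖) (y : F) :
    ‖adjoint A y‖ ≤ ‖y‖ := by
  have hsq : ‖adjoint A y‖ ^ 2 ≤ ‖y‖ * ‖adjoint A y‖ :=
    calc ‖adjoint A y‖ ^ 2 = (inner ℂ y (A (adjoint A y))).re := by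
          rw [← adjoint_inner_left]
          exact (inner_self_eq_norm_sq (𝕜 := ℂ) _).symm
      _ ≤ ‖y‖ * ‖A (adjoint A y)‖ := re_inner_le_norm (𝕜 := ℂ) _ _
      _ ≤ ‖y‖ * ‖adjoint A y‖ := by gcongr; exact hA _
  rcases (norm_nonneg (adjoint A y)).eq_or_lt with h0 | hpos
  · exact h0 ▸ norm_nonneg y
  · exact le_of_mul_le_mul_right (by rwa [sq] at hsq) hpos

lemma hsNormSq_comp_le_left (A : F →ₗ[ℂ] G) {B : E →ₗ[ℂ] F} (hB : ∀ z, ‖B z‖ ≤ ‖z‖) :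
    hsNormSq (A ∘ₗ B) ≤ hsNormSq A := by
  rw [← hsNormSq_adjoint, ← hsNormSq_adjoint A, adjoint_comp]
  exact hsNormSq_comp_le_right (norm_adjoint_apply_le hB) _

lemma sq_norm_apply_le_hsNormSq_mul (A : E →ₗ[ℂ] F) (z : E) :
    ‖A z‖ ^ 2 ≤ hsNormSq A * ‖z‖ ^ 2 := by
  have c := stdOrthonormalBasis ℂ F
  rw [← c.sum_sq_norm_inner_right, ← hsNormSq_adjoint, hsNormSq_eq_sum c, Finset.sum_mul]
  refine Finset.sum_le_sum fun i _ => ?_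
  rw [← adjoint_inner_left, ← mul_pow]
  exact pow_le_pow_left₀ (norm_nonneg _) (norm_inner_le_norm _ _) 2

lemma hsNormSq_starProjection (W : Submodule ℂ E) :
    hsNormSq (W.starProjection : E →ₗ[ℂ] E) = Module.finrank ℂ W := by
  have hproj : IsProj W (W.starProjection : E →ₗ[ℂ] E) :=
    ⟨W.starProjection_apply_mem, fun _ hx => W.starProjection_eq_self_iff.2 hx⟩
  have hself : adjoint (W.starProjection : E →ₗ[ℂ] E) = W.starProjection :=
    (eq_adjoint_iff _ _).2 (fun x y => W.inner_starProjection_left_eq_right x y) |>.symm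
  have hidem : (W.starProjection : E →ₗ[ℂ] E) ∘ₗ W.starProjection = W.starProjection :=
    LinearMap.ext fun z => hproj.map_id _ (hproj.map_mem z)
  rw [hsNormSq, hself, hidem, hproj.trace]
  simp

end HilbertSchmidt

section WeightedSums

variable {κ : Type*} [Fintype κ]

lemma inv_one_sub_le_exp {x : ℝ} (hx : x < 1) : (1 - x)⁻¹ ≤ Real.exp (x + x ^ 2 / (1 - x)) := by
  have hx' : 1 - x ≠ 0 := (sub_pos.2 hx).ne'
  have hsplit : (1 - x)⁻¹ = (x + x ^ 2 / (1 - x)) + 1 := by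
    field_simp
    ring
  exact hsplit ▸ Real.add_one_le_exp _

lemma lintegral_pi_prod {X : κ → Type*} [∀ i, MeasurableSpace (X i)]
    {μ : ∀ i, Measure (X i)} [∀ i, IsProbabilityMeasure (μ i)] {f : ∀ i, X i → ℝ≥0∞}
    (hf : ∀ i, Measurable (f i)) :
    ∫⁻ w, ∏ i, f i (w i) ∂(Measure.pi μ) = ∏ i, ∫⁻ z, f i z ∂(μ i) := by
  refine (lintegral_prod_eq_prod_lintegral_of_indepFun Finset.univ
    (fun i (w : ∀ i, X i) => f i (w i)) (iIndepFun_pi fun i => (hf i).aemeasurable)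
    (fun i => by fun_prop)).trans ?_
  exact Finset.prod_congr rfl fun i _ => (measurePreserving_eval μ i).lintegral_comp (hf i)

lemma lintegral_exp_weighted_sum_le {h : κ → ℝ} {a v l : ℝ} (hl : 0 ≤ l) (hla : l * a < 1)
    (hmax : ∀ i, h i ≤ a) (hsq : ∑ i, h i ^ 2 ≤ v) :
    ∫⁻ w, ENNReal.ofReal (Real.exp (l * ∑ i, h i * (‖w i‖ ^ 2 / 2)))
        ∂(Measure.pi fun _ : κ => stdGaussian ℂ)
      ≤ ENNReal.ofReal (Real.exp (l * ∑ i, h i + l ^ 2 / (1 - l * a) * v)) := by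
  have hlh : ∀ i, l * h i ≤ l * a := fun i => mul_le_mul_of_nonneg_left (hmax i) hl
  have hlh1 : ∀ i, l * h i < 1 := fun i => (hlh i).trans_lt hla
  have hterm : ∀ i, (l * h i) ^ 2 / (1 - l * h i) ≤ l ^ 2 / (1 - l * a) * h i ^ 2 := fun i => by
    rw [mul_pow, div_mul_eq_mul_div (l ^ 2)]
    exact div_le_div_of_nonneg_left (by positivity) (sub_pos.2 hla) (sub_le_sub_left (hlh i) 1)
  simp_rw [Finset.mul_sum, Real.exp_sum, ← mul_assoc,
    ENNReal.ofReal_prod_of_nonneg fun _ _ => (Real.exp_pos _).le]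
  rw [lintegral_pi_prod (f := fun i (z : ℂ) =>
    ENNReal.ofReal (Real.exp (l * h i * (‖z‖ ^ 2 / 2)))) fun i => by fun_prop]
  simp_rw [lintegral_exp_mul_sq_norm_stdGaussian (hlh1 _)]
  rw [← ENNReal.ofReal_prod_of_nonneg fun i _ => inv_nonneg.2 (sub_pos.2 (hlh1 i)).le]
  refine ENNReal.ofReal_le_ofReal ?_
  calc ∏ i, (1 - l * h i)⁻¹
      ≤ ∏ i, Real.exp (l * h i + (l * h i) ^ 2 / (1 - l * h i)) :=
        Finset.prod_le_prod (fun i _ => inv_nonneg.2 (sub_pos.2 (hlh1 i)).le)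
          fun i _ => inv_one_sub_le_exp (hlh1 i)
    _ = Real.exp (∑ i, (l * h i + (l * h i) ^ 2 / (1 - l * h i))) := (Real.exp_sum _ _).symm
    _ ≤ Real.exp (∑ i, (l * h i + l ^ 2 / (1 - l * a) * h i ^ 2)) :=
        Real.exp_le_exp.2 (Finset.sum_le_sum fun i _ => add_le_add_right (hterm i) _)
    _ = Real.exp (∑ i, l * h i + l ^ 2 / (1 - l * a) * ∑ i, h i ^ 2) := by
        rw [Finset.sum_add_distrib, Finset.mul_sum]
    _ ≤ Real.exp (∑ i, l * h i + l ^ 2 / (1 - l * a) * v) := by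
        have := sub_pos.2 hla
        gcongr

lemma measure_le_ofReal_exp_of_lintegral_exp_le {Ω : Type*} [MeasurableSpace Ω] {μ : Measure Ω}
    {X : Ω → ℝ} (hX : Measurable X) {l B c : ℝ} (hl : 0 ≤ l)
    (hexp : ∫⁻ ω, ENNReal.ofReal (Real.exp (l * X ω)) ∂μ ≤ ENNReal.ofReal (Real.exp (l * B + c))) :
    μ {ω | B ≤ X ω} ≤ ENNReal.ofReal (Real.exp c) := by
  have hpos : ENNReal.ofReal (Real.exp (l * B)) ≠ 0 := by simpa using Real.exp_pos _
  have hsub : {ω | B ≤ X ω} ⊆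
      {ω | ENNReal.ofReal (Real.exp (l * B)) ≤ ENNReal.ofReal (Real.exp (l * X ω))} :=
    fun ω (hω : B ≤ X ω) => ENNReal.ofReal_le_ofReal
      (Real.exp_le_exp.2 (mul_le_mul_of_nonneg_left hω hl))
  have hmarkov := (mul_meas_ge_le_lintegral (μ := μ)
    (f := fun ω => ENNReal.ofReal (Real.exp (l * X ω))) (by fun_prop)
    (ENNReal.ofReal (Real.exp (l * B)))).trans hexp
  rw [Real.exp_add, ENNReal.ofReal_mul (Real.exp_pos _).le] at hmarkov
  exact (measure_mono hsub).trans
    ((ENNReal.mul_le_mul_iff_right hpos ENNReal.ofReal_ne_top).1 hmarkov)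

-- Laurent-Massart: with `v = p²` and `t = q²`, Chernoff's bound is used at `l = q / (p + a q)`.
lemma weighted_sum_tail {h : κ → ℝ} {v a t : ℝ} (hv : 0 < v) (ha : 0 ≤ a) (ht : 0 ≤ t)
    (hsq : ∑ i, h i ^ 2 ≤ v) (hmax : ∀ i, h i ≤ a) :
    Measure.pi (fun _ : κ => stdGaussian ℂ)
      {w | 2 * ∑ i, h i + 4 * √(v * t) + 2 * a * t ≤ ∑ i, h i * ‖w i‖ ^ 2}
      ≤ ENNReal.ofReal (Real.exp (-t)) := by
  obtain ⟨p, hp, rfl⟩ : ∃ p : ℝ, 0 < p ∧ v = p ^ 2 :=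
    ⟨√v, Real.sqrt_pos.2 hv, (Real.sq_sqrt hv.le).symm⟩
  obtain ⟨q, hq, rfl⟩ : ∃ q : ℝ, 0 ≤ q ∧ t = q ^ 2 :=
    ⟨√t, Real.sqrt_nonneg t, (Real.sq_sqrt ht).symm⟩
  have : 0 < p + a * q := by positivity
  have hla : 1 - q / (p + a * q) * a = p / (p + a * q) := by
    field_simp
    ring
  have hla1 : q / (p + a * q) * a < 1 := by
    rw [← sub_pos, hla]
    positivity
  have hexponent : q / (p + a * q) * ∑ i, h i
        + (q / (p + a * q)) ^ 2 / (1 - q / (p + a * q) * a) * p ^ 2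
      = q / (p + a * q) * (∑ i, h i + 2 * (p * q) + a * q ^ 2) + -q ^ 2 := by
    rw [hla]
    field_simp
    ring
  have hmgf := lintegral_exp_weighted_sum_le (by positivity) hla1 hmax hsq
  rw [hexponent] at hmgf
  refine (measure_mono fun w hw => ?_).trans
    (measure_le_ofReal_exp_of_lintegral_exp_le (by fun_prop) (by positivity) hmgf)
  rw [Set.mem_ofPred_eq, ← mul_pow, Real.sqrt_sq (by positivity)] at hw
  simp_rw [Set.mem_ofPred_eq, ← mul_div_assoc, ← Finset.sum_div]
  linarith

end WeightedSums

section GaussianForms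

variable {ι : Type*} [Fintype ι]

lemma map_inner_basis_stdGaussian {κ : Type*} [Fintype κ]
    (b : OrthonormalBasis κ ℂ (EuclideanSpace ℂ ι)) :
    (stdGaussian (EuclideanSpace ℂ ι)).map (fun z i => inner ℂ (b i) z)
      = Measure.pi fun _ : κ => stdGaussian ℂ := by
  let f : EuclideanSpace ℂ ι ≃ₗᵢ[ℝ] EuclideanSpace ℂ κ :=
    { b.repr.toLinearEquiv.restrictScalars ℝ with norm_map' := b.repr.norm_map }
  have hcoord : (fun z i => inner ℂ (b i) z) = WithLp.ofLp ∘ f := by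
    ext z i
    exact (b.repr_apply_apply z i).symm
  rw [hcoord, ← Measure.map_map (by fun_prop) (by fun_prop), stdGaussian_map,
    ← map_pi_stdGaussian_complex, Measure.map_map (by fun_prop) (by fun_prop)]
  exact Measure.map_id

lemma map_inner_stdGaussian {e : EuclideanSpace ℂ ι} (he : ‖e‖ = 1) :
    (stdGaussian (EuclideanSpace ℂ ι)).map (fun z => inner ℂ e z) = stdGaussian ℂ := by
  have horth : Orthonormal ℂ (Subtype.val : ({e} : Set (EuclideanSpace ℂ ι)) → _) :=
    orthonormal_subsingleton_iff.2 fun x => by rw [x.2, he]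
  obtain ⟨u, b, hsub, hb⟩ := horth.exists_orthonormalBasis_extension
  let i : u := ⟨e, hsub rfl⟩
  have hcoord : (fun z => inner ℂ e z) = Function.eval i ∘ fun z i => inner ℂ (b i) z := by
    ext z
    simp [i, hb]
  rw [hcoord, ← Measure.map_map (by fun_prop) (by fun_prop), map_inner_basis_stdGaussian,
    (measurePreserving_eval _ i).map_eq]

lemma norm_inner_tail (a : EuclideanSpace ℂ ι) {t : ℝ} (ht : 0 ≤ t) :
    stdGaussian (EuclideanSpace ℂ ι) {z | ‖a‖ * √(2 * t) < ‖inner ℂ a z‖}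
      ≤ ENNReal.ofReal (Real.exp (-t)) := by
  rcases eq_or_ne a 0 with rfl | ha
  · simp
  have hpos : 0 < ‖a‖ := norm_pos_iff.2 ha
  have hunit : ‖((‖a‖⁻¹ : ℝ) : ℂ) • a‖ = 1 := by
    rw [norm_smul, Complex.norm_real, norm_inv, norm_norm, inv_mul_cancel₀ hpos.ne']
  rw [← stdGaussian_complex_sq_norm_tail ht, ← map_inner_stdGaussian hunit,
    Measure.map_apply (by fun_prop) (measurableSet_lt (by fun_prop) (by fun_prop))]
  refine measure_mono fun z hz => ?_
  rw [Set.mem_ofPred_eq] at hz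
  rw [Set.mem_preimage, Set.mem_ofPred_eq, inner_smul_left, Complex.conj_ofReal, norm_mul,
    Complex.norm_real, norm_inv, norm_norm, ← Real.sqrt_lt_sqrt_iff (by positivity),
    Real.sqrt_sq (by positivity), ← div_eq_inv_mul, lt_div_iff₀' hpos]
  exact hz

lemma exp_neg_div_le {p t : ℝ} (hp : 0 < p) (hp1 : p ≤ 1) (ht : 1 ≤ t) :
    Real.exp (-(t / p)) ≤ p * Real.exp (-t) := by
  have hinv : p⁻¹ ≤ Real.exp (p⁻¹ - 1) := by linarith [Real.add_one_le_exp (p⁻¹ - 1)]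
  have hone : 1 ≤ p⁻¹ := (one_le_inv₀ hp).2 hp1
  calc Real.exp (-(t / p)) ≤ Real.exp (-(p⁻¹ - 1) + -t) :=
        Real.exp_le_exp.2 (by rw [div_eq_mul_inv]; nlinarith)
    _ = (Real.exp (p⁻¹ - 1))⁻¹ * Real.exp (-t) := by rw [Real.exp_add, Real.exp_neg (p⁻¹ - 1)]
    _ ≤ p * Real.exp (-t) := by
        gcongr
        exact inv_le_of_inv_le₀ hp hinv

lemma norm_inner_tail_of_norm_le {a : EuclideanSpace ℂ ι} {B t : ℝ} (ht : 1 ≤ t) (ha : ‖a‖ ≤ B) :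
    stdGaussian (EuclideanSpace ℂ ι) {z | B * √(2 * t) < ‖inner ℂ a z‖}
      ≤ ENNReal.ofReal (‖a‖ ^ 2 / B ^ 2 * Real.exp (-t)) := by
  rcases eq_or_ne a 0 with rfl | h0
  · have hlevel : ¬ B * √(2 * t) < 0 :=
      not_lt.2 (mul_nonneg ((norm_nonneg _).trans ha) (Real.sqrt_nonneg _))
    simp only [inner_zero_left, norm_zero, hlevel, Set.ofPred_false, measure_empty, zero_le]
  have hpos : 0 < ‖a‖ := norm_pos_iff.2 h0
  have hB : 0 < B := hpos.trans_le ha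
  have hlevel : B * √(2 * t) = ‖a‖ * √(2 * (t / (‖a‖ ^ 2 / B ^ 2))) := by
    rw [show 2 * (t / (‖a‖ ^ 2 / B ^ 2)) = (B / ‖a‖) ^ 2 * (2 * t) by field_simp,
      Real.sqrt_mul (sq_nonneg (B / ‖a‖)), Real.sqrt_sq (by positivity), ← mul_assoc,
      mul_div_cancel₀ B hpos.ne']
  rw [hlevel]
  refine (norm_inner_tail a (by positivity)).trans (ENNReal.ofReal_le_ofReal
    (exp_neg_div_le (by positivity) (div_le_one_of_le₀ ?_ (by positivity)) ht))
  gcongr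

-- Weighting each functional by its share of the energy `B²` avoids a factor `card s`.
lemma exists_norm_inner_tail {κ : Type*} (s : Finset κ) (a : κ → EuclideanSpace ℂ ι) {B t : ℝ}
    (hB : 0 ≤ B) (ht : 1 ≤ t) (hsum : ∑ k ∈ s, ‖a k‖ ^ 2 ≤ B ^ 2) :
    stdGaussian (EuclideanSpace ℂ ι) {z | ∃ k ∈ s, B * √(2 * t) < ‖inner ℂ (a k) z‖}
      ≤ ENNReal.ofReal (Real.exp (-t)) := by
  have hle : ∀ k ∈ s, ‖a k‖ ≤ B := fun k hk => (sq_le_sq₀ (norm_nonneg _) hB).1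
    ((Finset.single_le_sum (f := fun k => ‖a k‖ ^ 2) (fun i _ => sq_nonneg _) hk).trans hsum)
  have hunion : {z | ∃ k ∈ s, B * √(2 * t) < ‖inner ℂ (a k) z‖}
      = ⋃ k ∈ s, {z | B * √(2 * t) < ‖inner ℂ (a k) z‖} := by
    ext z
    simp
  calc stdGaussian (EuclideanSpace ℂ ι) {z | ∃ k ∈ s, B * √(2 * t) < ‖inner ℂ (a k) z‖}
      ≤ ∑ k ∈ s, stdGaussian (EuclideanSpace ℂ ι) {z | B * √(2 * t) < ‖inner ℂ (a k) z‖} :=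
        hunion ▸ measure_biUnion_finset_le s _
    _ ≤ ∑ k ∈ s, ENNReal.ofReal (‖a k‖ ^ 2 / B ^ 2 * Real.exp (-t)) :=
        Finset.sum_le_sum fun k hk => norm_inner_tail_of_norm_le ht (hle k hk)
    _ = ENNReal.ofReal ((∑ k ∈ s, ‖a k‖ ^ 2) / B ^ 2 * Real.exp (-t)) := by
        rw [← ENNReal.ofReal_sum_of_nonneg (fun k _ => by positivity), ← Finset.sum_mul,
          Finset.sum_div]
    _ ≤ ENNReal.ofReal (Real.exp (-t)) :=
        ENNReal.ofReal_le_ofReal (mul_le_of_le_one_left (Real.exp_pos _).le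
          (div_le_one_of_le₀ hsum (sq_nonneg B)))

lemma quadraticForm_tail {T : EuclideanSpace ℂ ι →ₗ[ℂ] EuclideanSpace ℂ ι} (hT : T.IsSymmetric)
    {v a t : ℝ} (hv : 0 < v) (ha : 0 ≤ a) (ht : 0 ≤ t) (hHS : hsNormSq T ≤ v)
    (hop : ∀ z, (inner ℂ z (T z)).re ≤ a * ‖z‖ ^ 2) :
    stdGaussian (EuclideanSpace ℂ ι)
      {z | 2 * (LinearMap.trace ℂ _ T).re + 4 * √(v * t) + 2 * a * t ≤ (inner ℂ z (T z)).re}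
      ≤ ENNReal.ofReal (Real.exp (-t)) := by
  let u := hT.eigenvectorBasis rfl
  let h := hT.eigenvalues rfl
  have hTu : ∀ i, T (u i) = (h i : ℂ) • u i := hT.apply_eigenvectorBasis rfl
  have htr : (LinearMap.trace ℂ _ T).re = ∑ i, h i := hT.re_trace_eq_sum_eigenvalues rfl
  have hform : ∀ z, (inner ℂ z (T z)).re = ∑ i, h i * ‖inner ℂ (u i) z‖ ^ 2 := fun z => by
    rw [← u.sum_inner_mul_inner, Complex.re_sum]
    refine Finset.sum_congr rfl fun i _ => ?_
    rw [← hT, hTu, inner_smul_left, Complex.conj_ofReal, mul_left_comm, ← inner_conj_symm z,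
      mul_comm ((starRingEnd ℂ) _), Complex.mul_conj, Complex.normSq_eq_norm_sq,
      ← Complex.ofReal_mul, Complex.ofReal_re]
  have hsq : ∑ i, h i ^ 2 ≤ v := by
    rw [hsNormSq_eq_sum u] at hHS
    simpa only [hTu, norm_smul, u.norm_eq_one, mul_one, Complex.norm_real, Real.norm_eq_abs,
      sq_abs] using hHS
  have hmax : ∀ i, h i ≤ a := fun i => by
    have := hop (u i)
    rw [hTu, inner_smul_right, inner_self_eq_norm_sq_to_K, u.norm_eq_one] at this
    simpa using this
  have htail := weighted_sum_tail hv ha ht hsq hmax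
  rw [← map_inner_basis_stdGaussian u, Measure.map_apply (by fun_prop)
    (measurableSet_le (by fun_prop) (by fun_prop))] at htail
  simp only [htr, hform]
  exact htail

lemma re_inner_apply_tail (K : EuclideanSpace ℂ ι →ₗ[ℂ] EuclideanSpace ℂ ι)
    {v t : ℝ} (hv : 0 < v) (ht : 0 ≤ t) (hHS : hsNormSq K ≤ v) :
    stdGaussian (EuclideanSpace ℂ ι)
      {z | 2 * (LinearMap.trace ℂ _ K).re + 4 * √(v * t) + 2 * √v * t ≤ (inner ℂ z (K z)).re}
      ≤ ENNReal.ofReal (Real.exp (-t)) := by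
  let T : EuclideanSpace ℂ ι →ₗ[ℂ] EuclideanSpace ℂ ι := (2⁻¹ : ℂ) • (K + LinearMap.adjoint K)
  have hT : T.IsSymmetric := fun x y => by
    simp only [T, LinearMap.smul_apply, LinearMap.add_apply, inner_smul_left, inner_smul_right,
      inner_add_left, inner_add_right, LinearMap.adjoint_inner_left, LinearMap.adjoint_inner_right,
      map_inv₀, Complex.conj_ofNat]
    rw [add_comm]
  have hform : ∀ z, (inner ℂ z (T z)).re = (inner ℂ z (K z)).re := fun z => by
    have hconj : inner ℂ z (LinearMap.adjoint K z) = (starRingEnd ℂ) (inner ℂ z (K z)) := by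
      rw [LinearMap.adjoint_inner_right, inner_conj_symm]
    rw [LinearMap.smul_apply, LinearMap.add_apply, inner_smul_right, inner_add_right, hconj,
      Complex.add_conj]
    simp
  have htr : (LinearMap.trace ℂ _ T).re = (LinearMap.trace ℂ _ K).re := by
    let b := stdOrthonormalBasis ℂ (EuclideanSpace ℂ ι)
    simp_rw [LinearMap.trace_eq_sum_inner _ b, Complex.re_sum, hform]
  have hTHS : hsNormSq T ≤ v := by
    have hadd := hsNormSq_add_le K (LinearMap.adjoint K)
    have hnorm : ‖(2⁻¹ : ℂ)‖ ^ 2 = 4⁻¹ := by norm_num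
    rw [hsNormSq_adjoint] at hadd
    rw [hsNormSq_smul, hnorm]
    linarith
  have hop : ∀ z, (inner ℂ z (T z)).re ≤ √v * ‖z‖ ^ 2 := fun z => by
    have hTz : ‖T z‖ ≤ √v * ‖z‖ := by
      refine (sq_le_sq₀ (norm_nonneg _) (by positivity)).1 ?_
      rw [mul_pow, Real.sq_sqrt hv.le]
      exact (sq_norm_apply_le_hsNormSq_mul T z).trans
        (mul_le_mul_of_nonneg_right hTHS (sq_nonneg _))
    calc (inner ℂ z (T z)).re ≤ ‖z‖ * ‖T z‖ := re_inner_le_norm (𝕜 := ℂ) z (T z)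
      _ ≤ ‖z‖ * (√v * ‖z‖) := mul_le_mul_of_nonneg_left hTz (norm_nonneg _)
      _ = √v * ‖z‖ ^ 2 := by ring
  simpa only [htr, hform] using quadraticForm_tail hT hv (Real.sqrt_nonneg v) ht hTHS hop

lemma exists_unit_lt_re_mul {w τ : ℂ} {β : ℝ} (h : 2 * ‖τ‖ + 2 * β < ‖w‖) :
    ∃ c ∈ ({1, -1, Complex.I, -Complex.I} : Finset ℂ), 2 * (c * τ).re + β < (c * w).re := by
  by_contra! hc
  have h1 := hc 1 (by simp)
  have h2 := hc (-1) (by simp)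
  have h3 := hc Complex.I (by simp)
  have h4 := hc (-Complex.I) (by simp)
  simp only [one_mul, neg_mul, Complex.neg_re, Complex.I_mul_re] at h1 h2 h3 h4
  have hre : |(w - 2 * τ).re| ≤ β := by
    rw [abs_le]
    constructor <;> simp <;> linarith
  have him : |(w - 2 * τ).im| ≤ β := by
    rw [abs_le]
    constructor <;> simp <;> linarith
  have hτ : ‖2 * τ‖ = 2 * ‖τ‖ := by rw [norm_mul, Complex.norm_ofNat]
  linarith [norm_le_norm_sub_add w (2 * τ), Complex.norm_le_abs_re_add_abs_im (w - 2 * τ)]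

lemma norm_inner_apply_tail (K : EuclideanSpace ℂ ι →ₗ[ℂ] EuclideanSpace ℂ ι)
    {v t : ℝ} (hv : 0 < v) (ht : 4 ≤ t) (hHS : hsNormSq K ≤ v) :
    stdGaussian (EuclideanSpace ℂ ι)
      {z | 2 * ‖LinearMap.trace ℂ _ K‖ + 8 * √v * t < ‖inner ℂ z (K z)‖}
      ≤ ENNReal.ofReal (4 * Real.exp (-t)) := by
  have hlevel : 4 * √(v * t) + 2 * √v * t ≤ 4 * √v * t := by
    have hsqrt : 2 ≤ √t := Real.le_sqrt_of_sq_le (by linarith)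
    have : 2 * √t ≤ t := by nlinarith [Real.sq_sqrt (show 0 ≤ t by linarith)]
    rw [Real.sqrt_mul hv.le]
    nlinarith [Real.sqrt_nonneg v]
  let bad (c : ℂ) : Set (EuclideanSpace ℂ ι) :=
    {z | 2 * (c * LinearMap.trace ℂ _ K).re + 4 * √v * t < (c * inner ℂ z (K z)).re}
  have hbad : ∀ c ∈ ({1, -1, Complex.I, -Complex.I} : Finset ℂ),
      stdGaussian (EuclideanSpace ℂ ι) (bad c) ≤ ENNReal.ofReal (Real.exp (-t)) := fun c hc => by
    have hnorm : ‖c‖ = 1 := by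
      simp only [Finset.mem_insert, Finset.mem_singleton] at hc
      rcases hc with rfl | rfl | rfl | rfl <;> simp
    have htail := re_inner_apply_tail (c • K) hv (by linarith : 0 ≤ t)
      (by rwa [hsNormSq_smul, hnorm, one_pow, one_mul])
    refine (measure_mono fun z hz => ?_).trans htail
    simp only [bad, Set.mem_ofPred_eq, LinearMap.smul_apply, inner_smul_right, map_smul,
      smul_eq_mul] at hz ⊢
    linarith
  have hcover : {z | 2 * ‖LinearMap.trace ℂ _ K‖ + 8 * √v * t < ‖inner ℂ z (K z)‖}
      ⊆ ⋃ c ∈ ({1, -1, Complex.I, -Complex.I} : Finset ℂ), bad c := fun z hz => by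
    obtain ⟨c, hc, hlt⟩ := exists_unit_lt_re_mul (w := inner ℂ z (K z))
      (τ := LinearMap.trace ℂ _ K) (β := 4 * √v * t)
      (by rw [Set.mem_ofPred_eq] at hz; linarith)
    exact Set.mem_biUnion hc hlt
  have hcard : (({1, -1, Complex.I, -Complex.I} : Finset ℂ).card : ℝ) ≤ 4 := by
    exact_mod_cast Finset.card_le_four
  calc _ ≤ ∑ c ∈ {1, -1, Complex.I, -Complex.I}, stdGaussian (EuclideanSpace ℂ ι) (bad c) :=
        (measure_mono hcover).trans (measure_biUnion_finset_le _ _)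
    _ ≤ ∑ _c ∈ ({1, -1, Complex.I, -Complex.I} : Finset ℂ), ENNReal.ofReal (Real.exp (-t)) :=
        Finset.sum_le_sum hbad
    _ ≤ ENNReal.ofReal (4 * Real.exp (-t)) := by
        rw [← ENNReal.ofReal_sum_of_nonneg fun _ _ => (Real.exp_pos _).le, Finset.sum_const,
          nsmul_eq_mul]
        exact ENNReal.ofReal_le_ofReal (mul_le_mul_of_nonneg_right hcard (Real.exp_pos _).le)

lemma norm_apply_tail {F : Type*} [NormedAddCommGroup F] [InnerProductSpace ℂ F]
    [FiniteDimensional ℂ F] {A : EuclideanSpace ℂ ι →ₗ[ℂ] F} (hA : ∀ z, ‖A z‖ ≤ ‖z‖) {v t : ℝ}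
    (hv : 0 < v) (ht : 0 ≤ t) (hHS : hsNormSq A ≤ v) :
    stdGaussian (EuclideanSpace ℂ ι) {z | √(2 * v) + √(2 * t) < ‖A z‖}
      ≤ ENNReal.ofReal (Real.exp (-t)) := by
  let T := LinearMap.adjoint A ∘ₗ A
  have hT : T.IsSymmetric := fun x y => by
    rw [LinearMap.comp_apply, LinearMap.comp_apply, LinearMap.adjoint_inner_left,
      LinearMap.adjoint_inner_right]
  have hform : ∀ z, (inner ℂ z (T z)).re = ‖A z‖ ^ 2 := fun z => by
    rw [LinearMap.comp_apply, LinearMap.adjoint_inner_right]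
    exact inner_self_eq_norm_sq (𝕜 := ℂ) _
  have htail := quadraticForm_tail hT (a := 1) hv zero_le_one ht
    ((hsNormSq_comp_le_right (norm_adjoint_apply_le hA) A).trans hHS)
    fun z => by rw [hform, one_mul]; exact pow_le_pow_left₀ (norm_nonneg _) (hA z) 2
  refine (measure_mono fun z hz => ?_).trans htail
  have hcross : √(2 * v) * √(2 * t) = 2 * √(v * t) := by
    rw [← Real.sqrt_mul (by positivity), show 2 * v * (2 * t) = 2 ^ 2 * (v * t) by ring,
      Real.sqrt_mul (by positivity), Real.sqrt_sq zero_le_two]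
  rw [Set.mem_ofPred_eq] at hz
  rw [Set.mem_ofPred_eq, hform, mul_one]
  calc 2 * hsNormSq A + 4 * √(v * t) + 2 * t ≤ 2 * v + 2 * (2 * √(v * t)) + 2 * t := by linarith
    _ = (√(2 * v) + √(2 * t)) ^ 2 := by
        rw [add_sq, Real.sq_sqrt (by positivity), Real.sq_sqrt (by positivity), mul_assoc, hcross]
    _ ≤ ‖A z‖ ^ 2 := pow_le_pow_left₀ (by positivity) hz.le 2

end GaussianForms

section Fourier

open scoped FourierTransform

lemma sum_fourierChar_sub {M s t : ℕ} (hs : s < M) (ht : t < M) :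
    ∑ k ∈ Finset.range M, (𝐞 (k * ((s - t) / M)) : ℂ) = if s = t then (M : ℂ) else 0 := by
  have hM : (M : ℝ) ≠ 0 := by exact_mod_cast (Nat.zero_le s).trans_lt hs |>.ne'
  have hpow : ∀ k : ℕ, (𝐞 (k * ((s - t) / M)) : ℂ) = (𝐞 ((s - t) / M) : ℂ) ^ k := fun k => by
    rw [← nsmul_eq_mul, AddChar.map_nsmul_eq_pow, Circle.coe_pow]
  simp_rw [hpow]
  split_ifs with hst
  · simp [hst]
  have hroot : IsPrimitiveRoot (𝐞 (1 / M) : ℂ) M := by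
    convert Complex.isPrimitiveRoot_exp M (by exact_mod_cast hM) using 1
    rw [Real.fourierChar_apply]
    push_cast
    ring_nf
  have hquot : (𝐞 ((s - t) / M) : ℂ) = (𝐞 (1 / M) : ℂ) ^ s / (𝐞 (1 / M) : ℂ) ^ t := by
    rw [← Circle.coe_pow, ← Circle.coe_pow, ← Circle.coe_div, ← AddChar.map_nsmul_eq_pow,
      ← AddChar.map_nsmul_eq_pow, ← AddChar.map_sub_eq_div]
    congr 2
    simp only [nsmul_eq_mul]
    ring
  have hne : (𝐞 ((s - t) / M) : ℂ) ≠ 1 := fun h =>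
    hst (hroot.pow_inj hs ht (eq_of_div_eq_one (hquot ▸ h)))
  rw [geom_sum_eq hne, hquot, div_pow, ← pow_mul, ← pow_mul, mul_comm s, mul_comm t, pow_mul,
    pow_mul, hroot.pow_eq_one]
  simp

lemma sum_sq_norm_sum_fourierChar_smul {V : Type*} [NormedAddCommGroup V] [InnerProductSpace ℂ V]
    {M N : ℕ} (hMN : M ≤ N) (v : ℕ → V) :
    ∑ k ∈ Finset.range N, ‖∑ τ ∈ Finset.range M, (𝐞 (-(k * τ / N)) : ℂ) • v τ‖ ^ 2
      = N * ∑ τ ∈ Finset.range M, ‖v τ‖ ^ 2 := by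
  have hphase : ∀ k s t : ℕ, (starRingEnd ℂ) (𝐞 (-(k * s / N)) : ℂ) * (𝐞 (-(k * t / N)) : ℂ)
      = (𝐞 (k * ((s - t) / N)) : ℂ) := fun k s t => by
    rw [← Circle.coe_inv_eq_conj, ← AddChar.map_neg_eq_inv, ← Circle.coe_mul,
      ← AddChar.map_add_eq_mul]
    ring_nf
  have hexpand : ∀ k : ℕ, ((‖∑ τ ∈ Finset.range M, (𝐞 (-(k * τ / N)) : ℂ) • v τ‖ ^ 2 : ℝ) : ℂ)
      = ∑ s ∈ Finset.range M, ∑ t ∈ Finset.range M,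
        (𝐞 (k * ((s - t) / N)) : ℂ) * inner ℂ (v s) (v t) := fun k => by
    rw [Complex.ofReal_pow]
    refine (inner_self_eq_norm_sq_to_K (𝕜 := ℂ)
      (∑ τ ∈ Finset.range M, (𝐞 (-(k * τ / N)) : ℂ) • v τ)).symm.trans ?_
    rw [sum_inner]
    simp_rw [inner_sum, inner_smul_left, inner_smul_right, ← mul_assoc, hphase]
  have hlt : ∀ {s}, s ∈ Finset.range M → s < N := fun hs => (Finset.mem_range.1 hs).trans_le hMN
  rw [← Complex.ofReal_inj, Complex.ofReal_sum, Finset.sum_congr rfl fun k _ => hexpand k,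
    Finset.sum_comm, Complex.ofReal_mul, Complex.ofReal_sum, Finset.mul_sum]
  refine Finset.sum_congr rfl fun s hs => ?_
  rw [Finset.sum_comm]
  simp_rw [← Finset.sum_mul]
  rw [Finset.sum_congr rfl fun t ht => by rw [sum_fourierChar_sub (hlt hs) (hlt ht)]]
  simp_rw [ite_mul, zero_mul]
  rw [Finset.sum_ite_eq, if_pos hs, inner_self_eq_norm_sq_to_K]
  push_cast
  rfl

/-- The Dirichlet kernel `∑_{τ < M} e^{2πiτy}`; up to sampling and scaling, these are the frequency
responses of the filters `mode m k`. -/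
def dirichletKernel (M : ℕ) (y : ℝ) : ℂ := ∑ τ ∈ Finset.range M, (𝐞 (τ * y) : ℂ)

lemma norm_dirichletKernel_le (M : ℕ) (y : ℝ) : ‖dirichletKernel M y‖ ≤ M := by
  calc ‖dirichletKernel M y‖ ≤ ∑ _τ ∈ Finset.range M, (1 : ℝ) :=
        norm_sum_le_of_le _ fun τ _ => (Circle.norm_coe _).le
    _ = M := by simp

lemma norm_sum_fourierChar_neg_mul (M : ℕ) (y : ℝ) :
    ‖∑ τ ∈ Finset.range M, (𝐞 (-(τ * y)) : ℂ)‖ = ‖dirichletKernel M y‖ := by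
  rw [dirichletKernel, ← Complex.norm_conj, map_sum]
  simp_rw [← Circle.coe_inv_eq_conj, ← AddChar.map_neg_eq_inv, neg_neg]

lemma dirichletKernel_add_one (M : ℕ) (y : ℝ) :
    dirichletKernel M (y + 1) = dirichletKernel M y := by
  refine Finset.sum_congr rfl fun τ _ => ?_
  have hτ : (𝐞 (τ : ℝ) : ℂ) = 1 := by
    rw [Real.fourierChar_apply, Complex.exp_eq_one_iff]
    exact ⟨τ, by push_cast; ring⟩
  rw [mul_add, mul_one, AddChar.map_add_eq_mul, Circle.coe_mul, hτ, mul_one]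

lemma two_mul_le_sin_pi_mul {y : ℝ} (h0 : 0 ≤ y) (h1 : y ≤ 1 / 2) :
    2 * y ≤ Real.sin (Real.pi * y) := by
  have hpi := Real.pi_pos
  have h := Real.mul_le_sin (x := Real.pi * y) (by positivity) (by nlinarith)
  rwa [← mul_assoc, div_mul_cancel₀ _ hpi.ne'] at h

lemma two_mul_mul_one_sub_le_sin_pi_mul {y : ℝ} (h0 : 0 ≤ y) (h1 : y ≤ 1) :
    2 * (y * (1 - y)) ≤ Real.sin (Real.pi * y) := by
  rcases le_total y (1 / 2) with h | h
  · have := two_mul_le_sin_pi_mul h0 h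
    nlinarith
  · have := two_mul_le_sin_pi_mul (y := 1 - y) (by linarith) (by linarith)
    rw [← Real.sin_pi_sub, ← mul_one_sub]
    nlinarith

lemma norm_fourierChar_sub_one (y : ℝ) : ‖(𝐞 y : ℂ) - 1‖ = 2 * |Real.sin (Real.pi * y)| := by
  rw [Real.fourierChar_apply, mul_comm, Complex.norm_exp_I_mul_ofReal_sub_one, norm_mul,
    Real.norm_ofNat, Real.norm_eq_abs, mul_assoc, mul_div_cancel_left₀ _ two_ne_zero]

lemma norm_dirichletKernel_le_inv (M : ℕ) {y : ℝ} (h0 : 0 < y) (h1 : y < 1) :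
    ‖dirichletKernel M y‖ ≤ 2⁻¹ * (y⁻¹ + (1 - y)⁻¹) := by
  have h1' : 0 < 1 - y := sub_pos.2 h1
  have hpos : 0 < y * (1 - y) := mul_pos h0 h1'
  have hden : 4 * (y * (1 - y)) ≤ ‖(𝐞 y : ℂ) - 1‖ := by
    rw [norm_fourierChar_sub_one]
    linarith [two_mul_mul_one_sub_le_sin_pi_mul h0.le h1.le, le_abs_self (Real.sin (Real.pi * y))]
  have hne : (𝐞 y : ℂ) ≠ 1 := fun h => by
    rw [h, sub_self, norm_zero] at hden
    linarith
  have hnum : ‖(𝐞 y : ℂ) ^ M - 1‖ ≤ 2 := by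
    refine (norm_sub_le _ _).trans (le_of_eq ?_)
    rw [norm_pow, Circle.norm_coe]
    norm_num
  have hgeom : dirichletKernel M y = ((𝐞 y : ℂ) ^ M - 1) / ((𝐞 y : ℂ) - 1) := by
    rw [← geom_sum_eq hne]
    refine Finset.sum_congr rfl fun τ _ => ?_
    rw [← nsmul_eq_mul, AddChar.map_nsmul_eq_pow, Circle.coe_pow]
  calc ‖dirichletKernel M y‖ = ‖(𝐞 y : ℂ) ^ M - 1‖ / ‖(𝐞 y : ℂ) - 1‖ := by
        rw [hgeom, norm_div]
    _ ≤ 2 / (4 * (y * (1 - y))) := by gcongr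
    _ = 2⁻¹ * (y⁻¹ + (1 - y)⁻¹) := by
        field_simp
        ring

lemma sum_range_add_of_periodic {N : ℕ} {g : ℤ → ℝ} (hg : ∀ l, g (l + N) = g l) (q : ℤ) :
    ∑ j ∈ Finset.range N, g (q + j) = ∑ j ∈ Finset.range N, g j := by
  have hstep : ∀ q : ℤ,
      ∑ j ∈ Finset.range N, g (q + 1 + j) = ∑ j ∈ Finset.range N, g (q + j) := fun q => by
    have hlast := Finset.sum_range_succ (fun j : ℕ => g (q + j)) N
    have hfirst := Finset.sum_range_succ' (fun j : ℕ => g (q + j)) N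
    have hcomm : ∀ j : ℕ, q + 1 + (j : ℤ) = q + (j + 1) := fun j => by ring
    simp only [hg, Nat.cast_zero, Nat.cast_succ, add_zero, ← hcomm] at hlast hfirst
    linarith
  induction q using Int.induction_on with
  | zero => simp
  | succ i ih => rw [hstep, ih]
  | pred i ih => rw [← ih, ← hstep (-(i : ℤ) - 1), sub_add_cancel]

lemma sum_range_inv_le {N : ℕ} (hN : N ≠ 0) :
    ∑ l ∈ Finset.range N, (l : ℝ)⁻¹ ≤ 1 + Real.log N := by
  obtain ⟨N, rfl⟩ := Nat.exists_eq_succ_of_ne_zero hN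
  have hharmonic : (harmonic N : ℝ) = ∑ l ∈ Finset.range (N + 1), (l : ℝ)⁻¹ := by
    rw [Finset.sum_range_succ', Nat.cast_zero, inv_zero, add_zero, harmonic]
    push_cast
    rfl
  have hmono : Real.log N ≤ Real.log (N + 1 : ℕ) := by
    rcases N.eq_zero_or_pos with rfl | hpos
    · simp
    · exact Real.log_le_log (by exact_mod_cast hpos) (by exact_mod_cast N.le_succ)
  rw [Nat.succ_eq_add_one, ← hharmonic]
  linarith [harmonic_le_one_add_log N]

lemma norm_dirichletKernel_grid_le {N l : ℕ} (M : ℕ) {δ : ℝ} (h0 : 0 ≤ δ) (h1 : δ ≤ 1)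
    (hl : 1 ≤ l) (hlN : l + 1 < N) :
    ‖dirichletKernel M ((δ + l) / N)‖ ≤ N * 2⁻¹ * ((l : ℝ)⁻¹ + ((N - 1 - l : ℕ) : ℝ)⁻¹) := by
  have : (0 : ℝ) < l := by exact_mod_cast hl
  have hNpos : (0 : ℝ) < N := by exact_mod_cast (by omega : 0 < N)
  have hgap : (l : ℝ) + 1 < N := by exact_mod_cast hlN
  have hcast : ((N - 1 - l : ℕ) : ℝ) = N - 1 - l := by
    rw [Nat.cast_sub (by omega), Nat.cast_sub (by omega), Nat.cast_one]
  have hcompl : 1 - (δ + l) / N = (N - (δ + l)) / N := by field_simp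
  calc ‖dirichletKernel M ((δ + l) / N)‖
      ≤ 2⁻¹ * (((δ + l) / N)⁻¹ + (1 - (δ + l) / N)⁻¹) :=
        norm_dirichletKernel_le_inv M (by positivity) (by rw [div_lt_one hNpos]; linarith)
    _ = N * 2⁻¹ * ((δ + l)⁻¹ + (N - (δ + l))⁻¹) := by
        rw [hcompl, inv_div, inv_div, div_eq_mul_inv, div_eq_mul_inv]
        ring
    _ ≤ N * 2⁻¹ * ((l : ℝ)⁻¹ + (N - 1 - l : ℝ)⁻¹) := by
        have hpos : (0 : ℝ) < N - 1 - l := by linarith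
        gcongr ?_ * (?_⁻¹ + ?_⁻¹) <;> linarith
    _ = _ := by rw [hcast]

lemma sum_range_norm_dirichletKernel_grid_le {N : ℕ} (hN : N ≠ 0) (M : ℕ) {δ : ℝ} (h0 : 0 ≤ δ)
    (h1 : δ ≤ 1) :
    ∑ l ∈ Finset.range N, ‖dirichletKernel M ((δ + l) / N)‖ ≤ 2 * M + N * (1 + Real.log N) := by
  have hterm : ∀ l ∈ Finset.range N, ‖dirichletKernel M ((δ + l) / N)‖ ≤
      (if l = 0 then (M : ℝ) else 0) + (if l = N - 1 then (M : ℝ) else 0)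
        + N * 2⁻¹ * ((l : ℝ)⁻¹ + ((N - 1 - l : ℕ) : ℝ)⁻¹) := fun l hl => by
    have hinv : (0 : ℝ) ≤ N * 2⁻¹ * ((l : ℝ)⁻¹ + ((N - 1 - l : ℕ) : ℝ)⁻¹) := by positivity
    have htriv := norm_dirichletKernel_le M ((δ + l) / N)
    have : (0 : ℝ) ≤ M := M.cast_nonneg
    have hlN := Finset.mem_range.1 hl
    split_ifs with hfirst hlast hlast
    · linarith
    · linarith
    · linarith
    · simpa using norm_dirichletKernel_grid_le M h0 h1 (by omega) (by omega)
  have hreflect : ∑ l ∈ Finset.range N, ((N - 1 - l : ℕ) : ℝ)⁻¹ = ∑ l ∈ Finset.range N, (l : ℝ)⁻¹ :=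
    Finset.sum_range_reflect (fun l : ℕ => (l : ℝ)⁻¹) N
  calc _ ≤ _ := Finset.sum_le_sum hterm
    _ = 2 * M + N * ∑ l ∈ Finset.range N, (l : ℝ)⁻¹ := by
        rw [Finset.sum_add_distrib, Finset.sum_add_distrib, ← Finset.mul_sum,
          Finset.sum_add_distrib, hreflect, Finset.sum_ite_eq', Finset.sum_ite_eq',
          if_pos (Finset.mem_range.2 (by omega)), if_pos (Finset.mem_range.2 (by omega))]
        ring
    _ ≤ 2 * M + N * (1 + Real.log N) := by
        gcongr
        exact sum_range_inv_le hN

lemma sum_norm_dirichletKernel_le {N : ℕ} (hN : N ≠ 0) (M : ℕ) (x : ℝ) :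
    ∑ j ∈ Finset.range N, ‖dirichletKernel M (x + j / N)‖ ≤ 2 * M + N * (1 + Real.log N) := by
  have hN0 : (N : ℝ) ≠ 0 := by exact_mod_cast hN
  let g : ℤ → ℝ := fun l => ‖dirichletKernel M ((Int.fract (N * x) + l) / N)‖
  have hper : ∀ l, g (l + N) = g l := fun l => by
    have hshift : (Int.fract (N * x) + ((l + N : ℤ) : ℝ)) / N
        = (Int.fract (N * x) + l) / N + 1 := by
      push_cast
      field_simp
      ring
    simp only [g, hshift, dirichletKernel_add_one]
  have hgrid : ∀ j : ℕ, ‖dirichletKernel M (x + j / N)‖ = g (⌊N * x⌋ + j) := fun j => by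
    have hpoint : x + j / N = (Int.fract (N * x) + ((⌊N * x⌋ + j : ℤ) : ℝ)) / N := by
      rw [Int.fract]
      push_cast
      field_simp
      ring
    rw [hpoint]
  simp_rw [hgrid]
  rw [sum_range_add_of_periodic hper]
  exact sum_range_norm_dirichletKernel_grid_le hN M (Int.fract_nonneg _) (Int.fract_lt_one _).le

end Fourier

section Modes

open scoped FourierTransform

/-- The `k`-th Fourier mode of length `m + 1`, with entries `e^{-2πikτ/(m+1)} / (m+1)`. The feasible
filters are the combinations of the modes whose coefficients have `ℓ₁`-norm at most `ρ`. -/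
def mode (m k : ℕ) : ℤ → ℂ := fun τ => ((m : ℂ) + 1)⁻¹ * 𝐞 (-(k * τ / (m + 1)))

variable {m : ℕ}

lemma norm_inv_natCast_add_one (m : ℕ) : ‖((m : ℂ) + 1)⁻¹‖ = ((m : ℝ) + 1)⁻¹ := by
  rw [norm_inv]
  exact_mod_cast congr_arg _ (Complex.norm_natCast (m + 1))

lemma norm_mode (k : ℕ) (τ : ℤ) : ‖mode m k τ‖ = ((m : ℝ) + 1)⁻¹ := by
  rw [mode, norm_mul, Circle.norm_coe, mul_one, norm_inv_natCast_add_one]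

lemma conj_mode (k : ℕ) (τ : ℤ) :
    (starRingEnd ℂ) (mode m k τ) = ((m : ℂ) + 1)⁻¹ * 𝐞 (k * τ / (m + 1)) := by
  rw [mode, map_mul, map_inv₀, map_add, map_one, Complex.conj_natCast, ← Circle.coe_inv_eq_conj,
    ← AddChar.map_neg_eq_inv, neg_neg]

lemma sum_conj_mode_mul_mode {s t : ℕ} (hs : s ∈ Finset.range (m + 1))
    (ht : t ∈ Finset.range (m + 1)) :
    ∑ k ∈ Finset.range (m + 1), (starRingEnd ℂ) (mode m k s) * mode m k t
      = if s = t then ((m : ℂ) + 1)⁻¹ else 0 := by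
  have hm : (m : ℂ) + 1 ≠ 0 := by exact_mod_cast m.succ_ne_zero
  have hterm : ∀ k : ℕ, (starRingEnd ℂ) (mode m k s) * mode m k t
      = (((m : ℂ) + 1)⁻¹ * ((m : ℂ) + 1)⁻¹) * 𝐞 (k * ((s - t) / (m + 1 : ℕ))) := fun k => by
    rw [conj_mode, mode, mul_mul_mul_comm, ← Circle.coe_mul, ← AddChar.map_add_eq_mul]
    congr 3
    push_cast
    ring
  rw [Finset.sum_congr rfl fun k _ => hterm k, ← Finset.mul_sum,
    sum_fourierChar_sub (Finset.mem_range.1 hs) (Finset.mem_range.1 ht)]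
  split_ifs
  · push_cast
    field_simp
  · rw [mul_zero]

lemma sum_sq_norm_sum_mode_smul {V : Type*} [NormedAddCommGroup V] [InnerProductSpace ℂ V]
    (v : ℕ → V) :
    ∑ k ∈ Finset.range (m + 1), ‖∑ τ ∈ Finset.range (m + 1), mode m k τ • v τ‖ ^ 2
      = ((m : ℝ) + 1)⁻¹ * ∑ τ ∈ Finset.range (m + 1), ‖v τ‖ ^ 2 := by
  have hmode : ∀ k, ‖∑ τ ∈ Finset.range (m + 1), mode m k τ • v τ‖ ^ 2 = (((m : ℝ) + 1)⁻¹) ^ 2 *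
      ‖∑ τ ∈ Finset.range (m + 1), (𝐞 (-(k * τ / (m + 1 : ℕ))) : ℂ) • v τ‖ ^ 2 := fun k => by
    rw [← norm_inv_natCast_add_one, ← mul_pow, ← norm_smul, Finset.smul_sum]
    simp only [smul_smul, mode, Nat.cast_succ, Int.cast_natCast]
  simp_rw [hmode]
  rw [← Finset.mul_sum, sum_sq_norm_sum_fourierChar_smul le_rfl, Nat.cast_succ]
  field_simp

lemma sqrt_mul_dft (φ : ℤ → ℂ) (k : ℕ) :
    (√((m : ℝ) + 1) : ℂ) * dft m φ k
      = ((m : ℂ) + 1) * ∑ s ∈ Finset.range (m + 1), φ s * (starRingEnd ℂ) (mode m k s) := by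
  have hm : (m : ℂ) + 1 ≠ 0 := by exact_mod_cast m.succ_ne_zero
  have hsqrt : √((m : ℝ) + 1) ≠ 0 := by positivity
  rw [dft, Complex.ofReal_inv, mul_inv_cancel_left₀ (Complex.ofReal_ne_zero.2 hsqrt),
    Finset.mul_sum]
  refine Finset.sum_congr rfl fun s _ => ?_
  rw [conj_mode, mul_left_comm, mul_inv_cancel_left₀ hm, Real.fourierChar_apply]
  push_cast
  ring_nf

lemma sum_dft_mul_mode (φ : ℤ → ℂ) {t : ℕ} (ht : t ∈ Finset.range (m + 1)) :
    ∑ k ∈ Finset.range (m + 1), (√((m : ℝ) + 1) : ℂ) * dft m φ k * mode m k t = φ t := by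
  have hm : (m : ℂ) + 1 ≠ 0 := by exact_mod_cast m.succ_ne_zero
  simp_rw [sqrt_mul_dft, mul_assoc, Finset.sum_mul, mul_assoc]
  rw [← Finset.mul_sum, Finset.sum_comm]
  simp_rw [← Finset.mul_sum]
  rw [Finset.sum_congr rfl fun s hs => by rw [sum_conj_mode_mul_mode hs ht]]
  simp_rw [mul_ite, mul_zero]
  rw [Finset.sum_ite_eq', if_pos ht, mul_comm (φ t), mul_inv_cancel_left₀ hm]

end Modes

section Filters

variable {m n : ℕ}

/-- The convolution with the filter which coincides with `u` on `[0, m]` and vanishes elsewhere, as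
a polynomial in the shift. -/
def filt (m : ℕ) (u : ℤ → ℂ) : Module.End ℂ (ℤ → ℂ) :=
  ∑ τ ∈ Finset.range (m + 1), u τ • shift ^ τ

lemma shift_pow_apply (τ : ℕ) (x : ℤ → ℂ) (t : ℤ) : (shift ^ τ) x t = x (t - τ) := by
  induction τ generalizing t with
  | zero => simp
  | succ τ ih =>
    rw [pow_succ', Module.End.mul_apply, Nat.cast_succ, add_comm, ← sub_sub]
    exact ih (t - 1)

lemma filt_apply (u x : ℤ → ℂ) (t : ℤ) :
    filt m u x t = ∑ τ ∈ Finset.range (m + 1), u τ * x (t - τ) := by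
  simp only [filt, LinearMap.sum_apply, Finset.sum_apply, LinearMap.smul_apply, Pi.smul_apply,
    shift_pow_apply, smul_eq_mul]

lemma conv_eq_filt {φ : ℤ → ℂ} (hφ : ∀ t : ℤ, t ∉ Set.Icc (0 : ℤ) m → φ t = 0) (x : ℤ → ℂ) :
    conv φ x = filt m φ x := by
  ext t
  let e : ℕ ↪ ℤ := Nat.castEmbedding
  have hsupp : ∀ τ ∉ (Finset.range (m + 1)).map e, φ τ * x (t - τ) = 0 := fun τ hτ => by
    rw [hφ τ, zero_mul]
    rintro ⟨h0, hm⟩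
    obtain ⟨k, rfl⟩ := Int.eq_ofNat_of_zero_le h0
    exact hτ (Finset.mem_map_of_mem e (Finset.mem_range.2 (by omega)))
  rw [conv, tsum_eq_sum hsupp, Finset.sum_map, filt_apply]
  rfl

lemma filt_mem {S : Submodule ℂ (ℤ → ℂ)} (hS : ∀ u ∈ S, shift u ∈ S) (φ : ℤ → ℂ) {x : ℤ → ℂ}
    (hx : x ∈ S) : filt m φ x ∈ S := by
  rw [filt, LinearMap.sum_apply]
  exact S.sum_mem fun τ _ => S.smul_mem _ (Module.End.pow_apply_mem_of_forall_mem τ hS x hx)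

lemma filt_eq_sum_mode (φ : ℤ → ℂ) :
    filt m φ = ∑ k ∈ Finset.range (m + 1),
      ((√((m : ℝ) + 1) : ℂ) * dft m φ k) • filt m (mode m k) := by
  simp_rw [filt, Finset.smul_sum, smul_smul]
  rw [Finset.sum_comm]
  simp_rw [← Finset.sum_smul]
  exact Finset.sum_congr rfl fun τ hτ => by rw [sum_dft_mul_mode φ hτ]

lemma norm_apply_filt_le {V : Type*} [SeminormedAddCommGroup V] [NormedSpace ℂ V]
    (L : (ℤ → ℂ) →ₗ[ℂ] V) {x φ : ℤ → ℂ} {ρ c : ℝ} (hφ : φ ∈ feasible m ρ)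
    (hL : ∀ k ∈ Finset.range (m + 1), ‖L (filt m (mode m k) x)‖ ≤ c) :
    ‖L (filt m φ x)‖ ≤ ρ * c := by
  have hc : 0 ≤ c := (norm_nonneg _).trans (hL 0 (Finset.mem_range.2 m.succ_pos))
  have hsqrt : 0 < √((m : ℝ) + 1) := by positivity
  have hcoeff : ∀ k, ‖(√((m : ℝ) + 1) : ℂ) * dft m φ k‖ = √((m : ℝ) + 1) * ‖dft m φ k‖ :=
    fun k => by rw [norm_mul, Complex.norm_real, Real.norm_of_nonneg hsqrt.le]
  rw [filt_eq_sum_mode]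
  simp only [LinearMap.sum_apply, LinearMap.smul_apply, map_sum, map_smul]
  calc ‖∑ k ∈ Finset.range (m + 1),
        ((√((m : ℝ) + 1) : ℂ) * dft m φ k) • L (filt m (mode m k) x)‖
      ≤ ∑ k ∈ Finset.range (m + 1), √((m : ℝ) + 1) * ‖dft m φ k‖ * c :=
        norm_sum_le_of_le _ fun k hk => by
          rw [norm_smul, hcoeff]
          exact mul_le_mul_of_nonneg_left (hL k hk) (by positivity)
    _ = √((m : ℝ) + 1) * fourierL1 m φ * c := by
        rw [← Finset.sum_mul, ← Finset.mul_sum, fourierL1]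
    _ ≤ ρ * c := by
        gcongr
        exact (le_div_iff₀' hsqrt).1 hφ.2

/-- The restriction of a sequence to the observation times `0, …, n`. -/
def restr (n : ℕ) : (ℤ → ℂ) →ₗ[ℂ] EuclideanSpace ℂ (Fin (n + 1)) where
  toFun x := WithLp.toLp 2 fun t => x t.val
  map_add' _ _ := rfl
  map_smul' _ _ := rfl

lemma norm_restr (x : ℤ → ℂ) : ‖restr n x‖ = l2norm n x := by
  rw [EuclideanSpace.norm_eq, l2norm, ← Fin.sum_univ_eq_sum_range (fun t => ‖x t‖ ^ 2)]
  rfl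

lemma sum_sq_norm_restr_filt_mode_le {ε : ℤ → ℂ} {B : ℝ}
    (hε : ∀ τ ≤ m, l2norm n ((shift ^ τ) ε) ≤ B) :
    ∑ k ∈ Finset.range (m + 1), ‖restr n (filt m (mode m k) ε)‖ ^ 2 ≤ B ^ 2 := by
  have hlag : ∀ τ ∈ Finset.range (m + 1), ‖restr n ((shift ^ τ) ε)‖ ≤ B := fun τ hτ => by
    rw [norm_restr]
    exact hε τ (Nat.lt_succ_iff.1 (Finset.mem_range.1 hτ))
  simp_rw [filt, LinearMap.sum_apply, LinearMap.smul_apply, map_sum, map_smul]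
  calc _ = ((m : ℝ) + 1)⁻¹ * ∑ τ ∈ Finset.range (m + 1), ‖restr n ((shift ^ τ) ε)‖ ^ 2 :=
        sum_sq_norm_sum_mode_smul _
    _ ≤ ((m : ℝ) + 1)⁻¹ * ∑ _τ ∈ Finset.range (m + 1), B ^ 2 := by
        gcongr with τ hτ
        exact hlag τ hτ
    _ = B ^ 2 := by
        rw [Finset.sum_const, Finset.card_range, nsmul_eq_mul, Nat.cast_succ,
          inv_mul_cancel_left₀ (by positivity)]

end Filters

section Window

open LinearMap
open scoped FourierTransform

/-- The space of complex vectors indexed by the observation window `[-m, n]`. -/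
abbrev WindowSpace (m n : ℕ) : Type := EuclideanSpace ℂ (Set.Icc (-(m : ℤ)) (n : ℤ))

/-- The restriction of a sequence to the window `[-m, n]`. -/
def window (m n : ℕ) : (ℤ → ℂ) →ₗ[ℂ] WindowSpace m n where
  toFun x := WithLp.toLp 2 fun t => x t
  map_add' _ _ := rfl
  map_smul' _ _ := rfl

/-- The extension by zero of a vector on the window. -/
def extend (m n : ℕ) : WindowSpace m n →ₗ[ℂ] (ℤ → ℂ) :=
  Function.ExtendByZero.linearMap ℂ Subtype.val ∘ₗ (WithLp.linearEquiv 2 ℂ _).toLinearMap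

/-- The restriction of a vector on the window to the observation times `0, …, n`. -/
def windowRestr (m n : ℕ) : WindowSpace m n →ₗ[ℂ] EuclideanSpace ℂ (Fin (n + 1)) :=
  restr n ∘ₗ extend m n

/-- The convolution with a filter supported on `[0, m]`, from the window to the observation times
`0, …, n`: the window is exactly what such a convolution depends on. -/
def windowFilt (m n : ℕ) (u : ℤ → ℂ) : WindowSpace m n →ₗ[ℂ] EuclideanSpace ℂ (Fin (n + 1)) :=
  restr n ∘ₗ filt m u ∘ₗ extend m n

variable {m n : ℕ}

lemma extend_apply (z : WindowSpace m n) {t : ℤ} (ht : t ∈ Set.Icc (-(m : ℤ)) (n : ℤ)) :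
    extend m n z t = z ⟨t, ht⟩ :=
  Subtype.val_injective.extend_apply _ _ (⟨t, ht⟩ : Set.Icc (-(m : ℤ)) (n : ℤ))

lemma windowRestr_apply (z : WindowSpace m n) (t : Fin (n + 1)) :
    windowRestr m n z t = z ⟨t, by constructor <;> omega⟩ :=
  extend_apply z _

lemma windowRestr_window (x : ℤ → ℂ) : windowRestr m n (window m n x) = restr n x := by
  ext t
  rw [windowRestr_apply]
  rfl

lemma windowFilt_window (u x : ℤ → ℂ) :
    windowFilt m n u (window m n x) = restr n (filt m u x) := by
  ext t
  change filt m u (extend m n (window m n x)) t = filt m u x t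
  rw [filt_apply, filt_apply]
  refine Finset.sum_congr rfl fun τ hτ => ?_
  have hτm := Finset.mem_range.1 hτ
  rw [extend_apply _ ⟨by omega, by omega⟩]
  rfl

lemma norm_windowRestr_le (z : WindowSpace m n) : ‖windowRestr m n z‖ ≤ ‖z‖ := by
  let e : Fin (n + 1) ↪ Set.Icc (-(m : ℤ)) (n : ℤ) :=
    ⟨fun t => ⟨t, by constructor <;> omega⟩,
      fun s t hst => Fin.ext (Nat.cast_injective (congr_arg Subtype.val hst))⟩
  rw [EuclideanSpace.norm_eq, EuclideanSpace.norm_eq]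
  refine Real.sqrt_le_sqrt ?_
  calc ∑ t, ‖windowRestr m n z t‖ ^ 2 = ∑ p ∈ Finset.univ.map e, ‖z p‖ ^ 2 := by
        rw [Finset.sum_map]
        exact Finset.sum_congr rfl fun t _ => by rw [windowRestr_apply]; rfl
    _ ≤ ∑ p, ‖z p‖ ^ 2 := Finset.sum_le_univ_sum_of_nonneg fun p => by positivity

lemma sum_window {A : Type*} [AddCommMonoid A] (f : ℤ → A) :
    ∑ t : Set.Icc (-(m : ℤ)) (n : ℤ), f t = ∑ q ∈ Finset.range (m + n + 1), f (q - m) := by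
  have hlen : ((n : ℤ) + 1 - -m).toNat = m + n + 1 := by omega
  rw [← Finset.sum_subtype (Finset.Icc (-(m : ℤ)) n) (fun t => by simp) f, Int.Icc_eq_finset_map,
    Finset.sum_map, hlen]
  refine Finset.sum_congr rfl fun q _ => congr_arg f ?_
  simp [sub_eq_neg_add]

/-- The characters `t ↦ e^{2πijt/N}` of `ℤ/Nℤ`, as sequences. -/
def character (N j : ℕ) : ℤ → ℂ := fun t => 𝐞 (j * t / N)

/-- The frequency response of the filter with entries `u_0, …, u_m` at the frequency `j / N`. -/
def response (m N : ℕ) (u : ℤ → ℂ) (j : ℕ) : ℂ :=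
  ∑ τ ∈ Finset.range (m + 1), u τ * 𝐞 (-(j * τ / N))

lemma filt_character (N : ℕ) (u : ℤ → ℂ) (j : ℕ) :
    filt m u (character N j) = response m N u j • character N j := by
  ext t
  rw [filt_apply, Pi.smul_apply, response, smul_eq_mul, Finset.sum_mul]
  refine Finset.sum_congr rfl fun τ _ => ?_
  rw [character, character, mul_assoc, ← Circle.coe_mul, ← AddChar.map_add_eq_mul]
  congr 3
  push_cast
  ring

lemma sq_norm_restr_character (N j : ℕ) : ‖restr n (character N j)‖ ^ 2 = n + 1 := by
  rw [EuclideanSpace.norm_sq_eq]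
  calc ∑ t : Fin (n + 1), ‖character N j t.val‖ ^ 2 = ∑ _t : Fin (n + 1), (1 : ℝ) :=
        Finset.sum_congr rfl fun t _ => by rw [character, Circle.norm_coe, one_pow]
    _ = n + 1 := by simp

lemma sum_sq_norm_response {N : ℕ} (hN : m + 1 ≤ N) (u : ℤ → ℂ) :
    ∑ j ∈ Finset.range N, ‖response m N u j‖ ^ 2
      = N * ∑ τ ∈ Finset.range (m + 1), ‖u τ‖ ^ 2 := by
  rw [← sum_sq_norm_sum_fourierChar_smul hN fun τ => u τ]
  simp_rw [response, smul_eq_mul, mul_comm]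

lemma inner_window_character {j k : ℕ} (hj : j < m + n + 1) (hk : k < m + n + 1) :
    inner ℂ (window m n (character (m + n + 1) j)) (window m n (character (m + n + 1) k))
      = if j = k then ((m + n + 1 : ℕ) : ℂ) else 0 := by
  set N := m + n + 1
  have hterm : ∀ q : ℕ, character N k (q - m) * (starRingEnd ℂ) (character N j (q - m))
      = (𝐞 (m * ((j - k) / N)) : ℂ) * 𝐞 (q * ((k - j) / N)) := fun q => by
    rw [character, character, ← Circle.coe_inv_eq_conj, ← AddChar.map_neg_eq_inv,
      ← Circle.coe_mul, ← AddChar.map_add_eq_mul, ← Circle.coe_mul, ← AddChar.map_add_eq_mul]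
    congr 2
    push_cast
    ring
  calc inner ℂ (window m n (character N j)) (window m n (character N k))
      = ∑ t : Set.Icc (-(m : ℤ)) (n : ℤ),
          character N k t * (starRingEnd ℂ) (character N j t) := PiLp.inner_apply _ _
    _ = ∑ q ∈ Finset.range N, (𝐞 (m * ((j - k) / N)) : ℂ) * 𝐞 (q * ((k - j) / N)) := by
        rw [sum_window fun t => character N k t * (starRingEnd ℂ) (character N j t)]
        exact Finset.sum_congr rfl fun q _ => hterm q
    _ = if j = k then (N : ℂ) else 0 := by
        rw [← Finset.mul_sum, sum_fourierChar_sub hk hj]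
        rcases eq_or_ne j k with rfl | hjk
        · simp
        · rw [if_neg hjk, if_neg hjk.symm, mul_zero]

/-- The orthonormal basis of the window formed by the normalized characters of `ℤ/(m+n+1)ℤ`, in
which every filter acts diagonally before the restriction to `0, …, n`. -/
def characterBasis (m n : ℕ) : OrthonormalBasis (Fin (m + n + 1)) ℂ (WindowSpace m n) :=
  have hon : Orthonormal ℂ fun j : Fin (m + n + 1) =>
      ((√(m + n + 1 : ℕ) : ℂ))⁻¹ • window m n (character (m + n + 1) j) := by
    rw [orthonormal_iff_ite]
    intro j k
    have hN : (√(m + n + 1 : ℕ) : ℂ) * √(m + n + 1 : ℕ) = (m + n + 1 : ℕ) := by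
      rw [← Complex.ofReal_mul, Real.mul_self_sqrt (Nat.cast_nonneg _), Complex.ofReal_natCast]
    have hN0 : ((m + n + 1 : ℕ) : ℂ) ≠ 0 := Nat.cast_ne_zero.2 (Nat.succ_ne_zero _)
    rw [inner_smul_left, inner_smul_right, inner_window_character j.2 k.2, map_inv₀,
      Complex.conj_ofReal, ← mul_assoc, ← mul_inv, hN, mul_ite, mul_zero, inv_mul_cancel₀ hN0]
    simp_rw [Fin.ext_iff]
  have hcard : Fintype.card (Fin (m + n + 1)) = Module.finrank ℂ (WindowSpace m n) := by
    rw [finrank_euclideanSpace, Fintype.card_fin, ← Set.toFinset_card, Set.toFinset_Icc,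
      Int.card_Icc]
    omega
  OrthonormalBasis.mk hon
    (hon.linearIndependent.span_eq_top_of_card_eq_finrank hcard).ge

lemma characterBasis_apply (j : Fin (m + n + 1)) :
    characterBasis m n j
      = window m n ((√(m + n + 1 : ℕ) : ℂ)⁻¹ • character (m + n + 1) j) := by
  rw [characterBasis, OrthonormalBasis.coe_mk, map_smul]

lemma windowFilt_characterBasis (u : ℤ → ℂ) (j : Fin (m + n + 1)) :
    windowFilt m n u (characterBasis m n j)
      = response m (m + n + 1) u j • windowRestr m n (characterBasis m n j) := by
  rw [characterBasis_apply, windowFilt_window, windowRestr_window, map_smul, filt_character]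
  simp only [map_smul]
  rw [smul_comm]

lemma sq_norm_windowRestr_characterBasis (j : Fin (m + n + 1)) :
    ‖windowRestr m n (characterBasis m n j)‖ ^ 2 = (n + 1) / (m + n + 1) := by
  rw [characterBasis_apply, windowRestr_window, map_smul, norm_smul, mul_pow,
    sq_norm_restr_character, norm_inv, Complex.norm_real, Real.norm_of_nonneg (Real.sqrt_nonneg _),
    inv_pow, Real.sq_sqrt (Nat.cast_nonneg _)]
  push_cast
  ring

lemma hsNormSq_windowFilt (u : ℤ → ℂ) :
    hsNormSq (windowFilt m n u) = (n + 1) * ∑ τ ∈ Finset.range (m + 1), ‖u τ‖ ^ 2 := by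
  rw [hsNormSq_eq_sum (characterBasis m n)]
  simp_rw [windowFilt_characterBasis, norm_smul, mul_pow, sq_norm_windowRestr_characterBasis]
  rw [← Finset.sum_mul,
    Fin.sum_univ_eq_sum_range (fun j => ‖response m (m + n + 1) u j‖ ^ 2) (m + n + 1),
    sum_sq_norm_response (by omega)]
  push_cast
  field_simp

lemma norm_trace_adjoint_windowRestr_comp_le (u : ℤ → ℂ)
    {Q : Module.End ℂ (EuclideanSpace ℂ (Fin (n + 1)))} (hQ : ∀ y, ‖Q y‖ ≤ ‖y‖) :
    ‖trace ℂ _ (adjoint (windowRestr m n) ∘ₗ Q ∘ₗ windowFilt m n u)‖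
      ≤ (∑ j ∈ Finset.range (m + n + 1), ‖response m (m + n + 1) u j‖)
        * ((n + 1) / (m + n + 1)) := by
  let b := characterBasis m n
  rw [trace_eq_sum_inner _ b, ← Fin.sum_univ_eq_sum_range, Finset.sum_mul]
  refine norm_sum_le_of_le _ fun j _ => ?_
  calc ‖inner ℂ (b j) ((adjoint (windowRestr m n) ∘ₗ Q ∘ₗ windowFilt m n u) (b j))‖
      = ‖response m (m + n + 1) u j‖
          * ‖inner ℂ (windowRestr m n (b j)) (Q (windowRestr m n (b j)))‖ := by
        rw [comp_apply, comp_apply, adjoint_inner_right, windowFilt_characterBasis, map_smul,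
          inner_smul_right, norm_mul]
    _ ≤ ‖response m (m + n + 1) u j‖ * (‖windowRestr m n (b j)‖ * ‖windowRestr m n (b j)‖) := by
        gcongr
        exact (norm_inner_le_norm _ _).trans (by gcongr; exact hQ _)
    _ = _ := by rw [← sq, sq_norm_windowRestr_characterBasis]

lemma norm_response_mode (N k j : ℕ) :
    ‖response m N (mode m k) j‖
      = ((m : ℝ) + 1)⁻¹ * ‖dirichletKernel (m + 1) (k / (m + 1) + j / N)‖ := by
  have hterm : ∀ τ : ℕ, mode m k τ * (𝐞 (-(j * τ / N)) : ℂ)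
      = ((m : ℂ) + 1)⁻¹ * 𝐞 (-(τ * (k / (m + 1) + j / N))) := fun τ => by
    rw [mode, mul_assoc, ← Circle.coe_mul, ← AddChar.map_add_eq_mul]
    congr 3
    push_cast
    ring
  rw [response, Finset.sum_congr rfl fun τ _ => hterm τ, ← Finset.mul_sum, norm_mul,
    norm_inv_natCast_add_one, norm_sum_fourierChar_neg_mul]

lemma sum_norm_response_mode_le {N : ℕ} (hN : N ≠ 0) (k : ℕ) :
    ∑ j ∈ Finset.range N, ‖response m N (mode m k) j‖
      ≤ 2 + N / (m + 1) * (1 + Real.log N) := by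
  simp_rw [norm_response_mode, ← Finset.mul_sum]
  calc _ ≤ ((m : ℝ) + 1)⁻¹ * (2 * (m + 1 : ℕ) + N * (1 + Real.log N)) := by
        gcongr
        exact sum_norm_dirichletKernel_le hN _ _
    _ = 2 + N / (m + 1) * (1 + Real.log N) := by
        push_cast
        field_simp

lemma hsNormSq_windowFilt_mode (k : ℕ) :
    hsNormSq (windowFilt m n (mode m k)) = kappa m n ^ 2 := by
  rw [hsNormSq_windowFilt, kappa, Real.sq_sqrt (by positivity)]
  simp_rw [norm_mode]
  rw [Finset.sum_const, Finset.card_range, nsmul_eq_mul, Nat.cast_succ]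
  field_simp

lemma norm_trace_adjoint_windowRestr_comp_mode_le (k : ℕ)
    {Q : Module.End ℂ (EuclideanSpace ℂ (Fin (n + 1)))} (hQ : ∀ y, ‖Q y‖ ≤ ‖y‖) :
    ‖trace ℂ _ (adjoint (windowRestr m n) ∘ₗ Q ∘ₗ windowFilt m n (mode m k))‖
      ≤ 2 + kappa m n ^ 2 * (1 + Real.log (m + n + 1)) := by
  have hratio : ((n : ℝ) + 1) / (m + n + 1) ≤ 1 := by
    rw [div_le_one (by positivity)]
    linarith [(Nat.cast_nonneg m : (0 : ℝ) ≤ m)]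
  calc _ ≤ (2 + (m + n + 1 : ℕ) / (m + 1) * (1 + Real.log (m + n + 1 : ℕ)))
        * (((n : ℝ) + 1) / (m + n + 1)) := by
        refine (norm_trace_adjoint_windowRestr_comp_le _ hQ).trans ?_
        gcongr
        exact sum_norm_response_mode_le (Nat.succ_ne_zero _) k
    _ = 2 * (((n : ℝ) + 1) / (m + n + 1)) + kappa m n ^ 2 * (1 + Real.log (m + n + 1)) := by
        rw [kappa, Real.sq_sqrt (by positivity)]
        push_cast
        field_simp
    _ ≤ 2 + kappa m n ^ 2 * (1 + Real.log (m + n + 1)) := by linarith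

end Window

section NoiseEvent

open LinearMap

variable {m n : ℕ}

lemma kappa_pos (m n : ℕ) : 0 < kappa m n := by
  rw [kappa]
  positivity

lemma four_le_log : (4 : ℝ) ≤ Real.log 55 := by
  rw [Real.le_log_iff_exp_le (by norm_num)]
  calc Real.exp 4 = Real.exp 1 ^ 4 := by rw [← Real.exp_nat_mul]; norm_num
    _ ≤ 2.7182818286 ^ 4 := by gcongr; exact Real.exp_one_lt_d9.le
    _ ≤ 55 := by norm_num

lemma log_window_add_four_le (m n : ℕ) {α : ℝ} (hα : 0 < α) (hα1 : α ≤ 1) :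
    Real.log ((m : ℝ) + n + 1) + 4 ≤ Real.log (55 * ((m : ℝ) + n + 1) / α) := by
  rw [Real.log_div (by positivity) hα.ne', Real.log_mul (by norm_num) (by positivity)]
  linarith [four_le_log, Real.log_nonpos hα.le hα1]

lemma log_window_nonneg (m n : ℕ) : 0 ≤ Real.log ((m : ℝ) + n + 1) :=
  Real.log_nonneg (le_add_of_nonneg_left (by positivity))

lemma one_le_log_sixteen_div {α : ℝ} (hα : 0 < α) (hα1 : α ≤ 1) : 1 ≤ Real.log (16 / α) := by
  rw [Real.le_log_iff_exp_le (by positivity), le_div_iff₀ hα]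
  nlinarith [Real.exp_one_lt_d9, Real.exp_pos 1]

lemma exp_neg_log_div {a α : ℝ} (ha : 0 < a) (hα : 0 < α) :
    Real.exp (-Real.log (a / α)) = α / a := by
  rw [Real.exp_neg, Real.exp_log (by positivity), inv_div]

/-- The quadratic noise terms of all modes, projected onto `Wᗮ`, are at most `V_α`. -/
def quadraticEvent (m n : ℕ) (α : ℝ) (W : Submodule ℂ (EuclideanSpace ℂ (Fin (n + 1)))) :
    Set (WindowSpace m n) :=
  {z | ∀ k ∈ Finset.range (m + 1),
    ‖inner ℂ (Wᗮ.starProjection (windowRestr m n z)) (windowFilt m n (mode m k) z)‖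
      ≤ vAlpha m n α}

/-- The projection of the noise onto the subspace `W`, of dimension at most `s`, is controlled. -/
def projectionEvent (m n s : ℕ) (α : ℝ) (W : Submodule ℂ (EuclideanSpace ℂ (Fin (n + 1)))) :
    Set (WindowSpace m n) :=
  {z | ‖W.starProjection (windowRestr m n z)‖ ≤ √(2 * s) + cAlpha α}

/-- The correlations of the noise, projected onto `Wᗮ`, with the filtered deviations `ε` are
controlled for all modes; `B` is the bound on the norms of the shifts of `ε`. -/
def correlationEvent (m n : ℕ) (B α : ℝ) (W : Submodule ℂ (EuclideanSpace ℂ (Fin (n + 1))))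
    (ε : ℤ → ℂ) : Set (WindowSpace m n) :=
  {z | ∀ k ∈ Finset.range (m + 1),
    ‖inner ℂ (Wᗮ.starProjection (windowRestr m n z)) (restr n (filt m (mode m k) ε))‖
      ≤ B * cAlpha α}

variable {s : ℕ} {α B : ℝ} {W : Submodule ℂ (EuclideanSpace ℂ (Fin (n + 1)))} {ε : ℤ → ℂ}

lemma two_mul_norm_trace_mode_add_le (hα : 0 < α) (hα1 : α ≤ 1) (k : ℕ)
    {Q : Module.End ℂ (EuclideanSpace ℂ (Fin (n + 1)))} (hQ : ∀ y, ‖Q y‖ ≤ ‖y‖) :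
    2 * ‖trace ℂ _ (adjoint (windowRestr m n) ∘ₗ Q ∘ₗ windowFilt m n (mode m k))‖
      + 8 * √(kappa m n ^ 2) * Real.log (55 * ((m : ℝ) + n + 1) / α) ≤ vAlpha m n α := by
  set L := Real.log (55 * ((m : ℝ) + n + 1) / α) with hL
  have hκ := kappa_pos m n
  have hL4 : Real.log ((m : ℝ) + n + 1) + 4 ≤ L := log_window_add_four_le m n hα hα1
  have hL0 : 4 ≤ L := by linarith [log_window_nonneg m n]
  have htr : ‖trace ℂ _ (adjoint (windowRestr m n) ∘ₗ Q ∘ₗ windowFilt m n (mode m k))‖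
      ≤ 2 + kappa m n ^ 2 * L := by
    refine (norm_trace_adjoint_windowRestr_comp_mode_le k hQ).trans ?_
    gcongr
    linarith
  rw [Real.sqrt_sq hκ.le, vAlpha, ← hL]
  nlinarith [mul_pos hκ (by linarith : 0 < L),
    mul_nonneg (sq_nonneg (kappa m n)) (by linarith : 0 ≤ L)]

lemma inner_starProjection_mode_tail (hα : 0 < α) (hα1 : α ≤ 1)
    (U : Submodule ℂ (EuclideanSpace ℂ (Fin (n + 1)))) (k : ℕ) :
    stdGaussian (WindowSpace m n) {z | vAlpha m n α <
        ‖inner ℂ (U.starProjection (windowRestr m n z)) (windowFilt m n (mode m k) z)‖}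
      ≤ ENNReal.ofReal (4 * (α / (55 * ((m : ℝ) + n + 1)))) := by
  let Q : Module.End ℂ (EuclideanSpace ℂ (Fin (n + 1))) := U.starProjection
  let K := adjoint (windowRestr m n) ∘ₗ Q ∘ₗ windowFilt m n (mode m k)
  have hQ : ∀ y, ‖Q y‖ ≤ ‖y‖ := U.norm_starProjection_apply_le
  have hHS : hsNormSq K ≤ kappa m n ^ 2 := by
    rw [← hsNormSq_windowFilt_mode k]
    exact (hsNormSq_comp_le_right (norm_adjoint_apply_le norm_windowRestr_le) _).trans
      (hsNormSq_comp_le_right hQ _)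
  have hK : ∀ z, inner ℂ (U.starProjection (windowRestr m n z)) (windowFilt m n (mode m k) z)
      = inner ℂ z (K z) := fun z => by
    rw [Submodule.inner_starProjection_left_eq_right]
    exact (adjoint_inner_right _ _ _).symm
  have htail := norm_inner_apply_tail K (t := Real.log (55 * ((m : ℝ) + n + 1) / α))
    (pow_pos (kappa_pos m n) 2)
    (by linarith [log_window_add_four_le m n hα hα1, log_window_nonneg m n]) hHS
  rw [exp_neg_log_div (by positivity) hα] at htail
  refine (measure_mono fun z hz => ?_).trans htail
  rw [Set.mem_ofPred_eq, hK] at hz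
  exact (two_mul_norm_trace_mode_add_le hα hα1 k hQ).trans_lt hz

lemma stdGaussian_quadraticEvent_compl_le (hα : 0 < α) (hα1 : α ≤ 1)
    (W : Submodule ℂ (EuclideanSpace ℂ (Fin (n + 1)))) :
    stdGaussian (WindowSpace m n) (quadraticEvent m n α W)ᶜ ≤ ENNReal.ofReal (α / 13) := by
  have hunion : (quadraticEvent m n α W)ᶜ = ⋃ k ∈ Finset.range (m + 1), {z | vAlpha m n α <
      ‖inner ℂ (Wᗮ.starProjection (windowRestr m n z)) (windowFilt m n (mode m k) z)‖} := by
    ext z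
    simp only [quadraticEvent, Set.mem_compl_iff, Set.mem_ofPred_eq, Set.mem_iUnion, not_forall,
      not_le]
  have hcard : ((m + 1 : ℕ) : ℝ) * (4 * (α / (55 * ((m : ℝ) + n + 1)))) ≤ α / 13 := by
    have hwindow : ((m : ℝ) + 1) / (m + n + 1) ≤ 1 := by
      rw [div_le_one (by positivity)]
      linarith [(Nat.cast_nonneg n : (0 : ℝ) ≤ n)]
    calc _ = 4 * α / 55 * (((m : ℝ) + 1) / (m + n + 1)) := by push_cast; field_simp
      _ ≤ 4 * α / 55 * 1 := by gcongr
      _ ≤ α / 13 := by linarith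
  calc _ ≤ ∑ _k ∈ Finset.range (m + 1), ENNReal.ofReal (4 * (α / (55 * ((m : ℝ) + n + 1)))) := by
        rw [hunion]
        refine (measure_biUnion_finset_le _ _).trans (Finset.sum_le_sum fun k _ => ?_)
        exact inner_starProjection_mode_tail hα hα1 Wᗮ k
    _ ≤ ENNReal.ofReal (α / 13) := by
        rw [Finset.sum_const, Finset.card_range, nsmul_eq_mul, ← ENNReal.ofReal_natCast,
          ← ENNReal.ofReal_mul (Nat.cast_nonneg _)]
        exact ENNReal.ofReal_le_ofReal hcard

lemma stdGaussian_projectionEvent_compl_le (hα : 0 < α) (hα1 : α ≤ 1) (hs : 1 ≤ s)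
    (hW : Module.finrank ℂ W ≤ s) :
    stdGaussian (WindowSpace m n) (projectionEvent m n s α W)ᶜ ≤ ENNReal.ofReal (α / 16) := by
  let A : WindowSpace m n →ₗ[ℂ] EuclideanSpace ℂ (Fin (n + 1)) :=
    (W.starProjection : Module.End ℂ _) ∘ₗ windowRestr m n
  have hA : ∀ z, ‖A z‖ ≤ ‖z‖ := fun z =>
    (W.norm_starProjection_apply_le _).trans (norm_windowRestr_le z)
  have hHS : hsNormSq A ≤ s := by
    refine (hsNormSq_comp_le_left _ norm_windowRestr_le).trans ?_
    rw [hsNormSq_starProjection]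
    exact_mod_cast hW
  have htail := norm_apply_tail hA (t := Real.log (16 / α)) (by exact_mod_cast hs)
    (by linarith [one_le_log_sixteen_div hα hα1]) hHS
  rw [exp_neg_log_div (by norm_num) hα] at htail
  convert htail using 2
  ext z
  simp only [projectionEvent, Set.mem_compl_iff, Set.mem_ofPred_eq, not_le]
  rfl

lemma stdGaussian_correlationEvent_compl_le (hα : 0 < α) (hα1 : α ≤ 1) (hB : 0 ≤ B)
    (W : Submodule ℂ (EuclideanSpace ℂ (Fin (n + 1))))
    (hε : ∀ τ ≤ m, l2norm n ((shift ^ τ) ε) ≤ B) :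
    stdGaussian (WindowSpace m n) (correlationEvent m n B α W ε)ᶜ ≤ ENNReal.ofReal (α / 16) := by
  let a : ℕ → WindowSpace m n := fun k =>
    adjoint (windowRestr m n) (Wᗮ.starProjection (restr n (filt m (mode m k) ε)))
  have ha : ∀ k, ‖a k‖ ≤ ‖restr n (filt m (mode m k) ε)‖ := fun k =>
    (norm_adjoint_apply_le norm_windowRestr_le _).trans (Wᗮ.norm_starProjection_apply_le _)
  have hsum : ∑ k ∈ Finset.range (m + 1), ‖a k‖ ^ 2 ≤ B ^ 2 :=
    (Finset.sum_le_sum fun k _ => pow_le_pow_left₀ (norm_nonneg _) (ha k) 2).trans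
      (sum_sq_norm_restr_filt_mode_le hε)
  have hinner : ∀ k z, ‖inner ℂ (Wᗮ.starProjection (windowRestr m n z))
      (restr n (filt m (mode m k) ε))‖ = ‖inner ℂ (a k) z‖ := fun k z => by
    rw [Submodule.inner_starProjection_left_eq_right, norm_inner_symm, adjoint_inner_left]
  have htail := exists_norm_inner_tail _ a hB (one_le_log_sixteen_div hα hα1) hsum
  rw [exp_neg_log_div (by norm_num) hα] at htail
  convert htail using 2
  ext z
  simp only [correlationEvent, cAlpha, hinner, Set.mem_compl_iff, Set.mem_ofPred_eq, not_forall,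
    not_le, exists_prop]

/-- The noise vectors for which the quadratic, the low-dimensional and the linear error terms are
controlled simultaneously. -/
def noiseEvent (m n s : ℕ) (B α : ℝ) (W : Submodule ℂ (EuclideanSpace ℂ (Fin (n + 1))))
    (ε : ℤ → ℂ) : Set (WindowSpace m n) :=
  quadraticEvent m n α W ∩ projectionEvent m n s α W ∩ correlationEvent m n B α W ε

lemma measurableSet_noiseEvent : MeasurableSet (noiseEvent m n s B α W ε) := by
  have hrestr : Continuous (windowRestr m n) := continuous_of_finiteDimensional _
  have hfilt : ∀ u, Continuous (windowFilt m n u) := fun u => continuous_of_finiteDimensional _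
  have hquadratic : IsClosed (quadraticEvent m n α W) := by
    simp only [quadraticEvent, Set.ofPred_forall]
    exact isClosed_biInter fun k _ => isClosed_le (by fun_prop) continuous_const
  have hprojection : IsClosed (projectionEvent m n s α W) :=
    isClosed_le (by fun_prop) continuous_const
  have hcorrelation : IsClosed (correlationEvent m n B α W ε) := by
    simp only [correlationEvent, Set.ofPred_forall]
    exact isClosed_biInter fun k _ => isClosed_le (by fun_prop) continuous_const
  exact ((hquadratic.inter hprojection).inter hcorrelation).measurableSet

lemma ofReal_one_sub_le_stdGaussian_noiseEvent (hα : 0 < α) (hα1 : α ≤ 1) (hs : 1 ≤ s)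
    (hW : Module.finrank ℂ W ≤ s) (hB : 0 ≤ B) (hε : ∀ τ ≤ m, l2norm n ((shift ^ τ) ε) ≤ B) :
    ENNReal.ofReal (1 - α) ≤ stdGaussian (WindowSpace m n) (noiseEvent m n s B α W ε) := by
  have hcompl : stdGaussian (WindowSpace m n) (noiseEvent m n s B α W ε)ᶜ ≤ ENNReal.ofReal α :=
    calc _ ≤ ENNReal.ofReal (α / 13) + ENNReal.ofReal (α / 16) + ENNReal.ofReal (α / 16) := by
          rw [noiseEvent, Set.compl_inter, Set.compl_inter]
          refine (measure_union_le _ _).trans (add_le_add ((measure_union_le _ _).trans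
            (add_le_add ?_ ?_)) ?_)
          · exact stdGaussian_quadraticEvent_compl_le hα hα1 W
          · exact stdGaussian_projectionEvent_compl_le hα hα1 hs hW
          · exact stdGaussian_correlationEvent_compl_le hα hα1 hB W hε
      _ ≤ ENNReal.ofReal α := by
          rw [← ENNReal.ofReal_add (by positivity) (by positivity),
            ← ENNReal.ofReal_add (by positivity) (by positivity)]
          exact ENNReal.ofReal_le_ofReal (by linarith)
  rw [prob_compl_eq_one_sub measurableSet_noiseEvent] at hcompl
  rw [ENNReal.ofReal_sub _ hα.le, ENNReal.ofReal_one]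
  exact tsub_le_iff_tsub_le.1 hcompl

end NoiseEvent

section Deterministic

variable {m n s : ℕ} {ρ σ ϰ α B : ℝ} {x xS ε z φ φ' : ℤ → ℂ}

lemma observe_eq_add_smul (x : ℤ → ℂ) (σ : ℝ) (z : ℤ → ℂ) : observe x σ z = x + (σ : ℂ) • z := rfl

lemma norm_inner_restr_filt_le {v : EuclideanSpace ℂ (Fin (n + 1))} {c : ℝ} (hφ : φ ∈ feasible m ρ)
    (hv : ∀ k ∈ Finset.range (m + 1), ‖inner ℂ v (restr n (filt m (mode m k) x))‖ ≤ c) :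
    ‖inner ℂ v (restr n (filt m φ x))‖ ≤ ρ * c :=
  norm_apply_filt_le (innerₛₗ ℂ v ∘ₗ restr n) hφ hv

section Subspace

variable {W : Submodule ℂ (EuclideanSpace ℂ (Fin (n + 1)))}

lemma norm_inner_starProjection_filt_self_le (hz : window m n z ∈ quadraticEvent m n α W)
    (hφ : φ ∈ feasible m ρ) :
    ‖inner ℂ (Wᗮ.starProjection (restr n z)) (restr n (filt m φ z))‖ ≤ ρ * vAlpha m n α := by
  simp only [quadraticEvent, Set.mem_ofPred_eq, windowRestr_window, windowFilt_window] at hz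
  exact norm_inner_restr_filt_le hφ hz

lemma norm_inner_starProjection_filt_le (hz : window m n z ∈ correlationEvent m n B α W ε)
    (hφ : φ ∈ feasible m ρ) :
    ‖inner ℂ (Wᗮ.starProjection (restr n z)) (restr n (filt m φ ε))‖ ≤ ρ * (B * cAlpha α) := by
  simp only [correlationEvent, Set.mem_ofPred_eq, windowRestr_window] at hz
  exact norm_inner_restr_filt_le hφ hz

lemma norm_inner_le_add_norm_inner_orthogonal (hz : window m n z ∈ projectionEvent m n s α W)
    (v : EuclideanSpace ℂ (Fin (n + 1))) :
    ‖inner ℂ (restr n z) v‖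
      ≤ (√(2 * s) + cAlpha α) * ‖v‖ + ‖inner ℂ (Wᗮ.starProjection (restr n z)) v‖ := by
  simp only [projectionEvent, Set.mem_ofPred_eq, windowRestr_window] at hz
  calc ‖inner ℂ (restr n z) v‖ = ‖inner ℂ (W.starProjection (restr n z)) v
        + inner ℂ (Wᗮ.starProjection (restr n z)) v‖ := by
        rw [← inner_add_left, Submodule.starProjection_add_starProjection_orthogonal]
    _ ≤ _ := (norm_add_le _ _).trans (by
        gcongr
        exact (norm_inner_le_norm _ _).trans (by gcongr))

end Subspace

variable {S : Submodule ℂ (ℤ → ℂ)}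

-- On `S` the filters act within `S`, so `xS` disappears from the projection onto the complement.
lemma norm_inner_orthogonal_filt_observe_sub_le (hσ : 0 ≤ σ) (hS : ∀ u ∈ S, shift u ∈ S)
    (hxS : xS ∈ S) (hz : window m n z ∈ noiseEvent m n s B α (S.map (restr n)) ε)
    (hφ : φ ∈ feasible m ρ) (hφ' : φ' ∈ feasible m ρ) :
    ‖inner ℂ ((S.map (restr n))ᗮ.starProjection (restr n z))
        (restr n (filt m φ' (observe (xS + ε) σ z) - filt m φ (observe (xS + ε) σ z)))‖
      ≤ 2 * (ρ * (B * cAlpha α)) + 2 * σ * (ρ * vAlpha m n α) := by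
  obtain ⟨⟨hquadratic, -⟩, hcorrelation⟩ := hz
  set P := (S.map (restr n))ᗮ.starProjection (restr n z)
  have hsignal : inner ℂ P (restr n (filt m φ' xS - filt m φ xS)) = 0 :=
    Submodule.inner_left_of_mem_orthogonal
      (Submodule.mem_map_of_mem (S.sub_mem (filt_mem hS φ' hxS) (filt_mem hS φ hxS)))
      (Submodule.starProjection_apply_mem _ _)
  have hsplit : filt m φ' (observe (xS + ε) σ z) - filt m φ (observe (xS + ε) σ z)
      = (filt m φ' xS - filt m φ xS) + (filt m φ' ε - filt m φ ε)
        + (σ : ℂ) • (filt m φ' z - filt m φ z) := by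
    simp only [observe_eq_add_smul, map_add, map_smul, smul_sub]
    abel
  have hdeviation : ‖inner ℂ P (restr n (filt m φ' ε - filt m φ ε))‖
      ≤ 2 * (ρ * (B * cAlpha α)) := by
    rw [map_sub, inner_sub_right, two_mul]
    exact norm_sub_le_of_le (norm_inner_starProjection_filt_le hcorrelation hφ')
      (norm_inner_starProjection_filt_le hcorrelation hφ)
  have hnoise : ‖inner ℂ P (restr n (filt m φ' z - filt m φ z))‖ ≤ 2 * (ρ * vAlpha m n α) := by
    rw [map_sub, inner_sub_right, two_mul]
    exact norm_sub_le_of_le (norm_inner_starProjection_filt_self_le hquadratic hφ')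
      (norm_inner_starProjection_filt_self_le hquadratic hφ)
  rw [hsplit, map_add, map_add, inner_add_right, inner_add_right, hsignal, zero_add, map_smul,
    inner_smul_right]
  refine norm_add_le_of_le hdeviation ?_
  rw [norm_mul, Complex.norm_real, Real.norm_of_nonneg hσ, mul_comm 2 σ, mul_assoc]
  gcongr

lemma sq_norm_le_of_norm_add_le {𝕜 E : Type*} [RCLike 𝕜] [SeminormedAddCommGroup E]
    [InnerProductSpace 𝕜 E] {r r' w : E} (h : ‖r' + w‖ ≤ ‖r + w‖) :
    ‖r'‖ ^ 2 ≤ ‖r‖ ^ 2 + 2 * ‖inner 𝕜 w (r - r')‖ := by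
  have hsq := pow_le_pow_left₀ (norm_nonneg _) h 2
  rw [norm_add_sq (𝕜 := 𝕜), norm_add_sq (𝕜 := 𝕜), inner_re_symm r', inner_re_symm r] at hsq
  have hre := RCLike.re_le_norm (inner 𝕜 w (r - r'))
  rw [inner_sub_right, map_sub] at hre
  rw [inner_sub_right]
  linarith

lemma le_of_sq_le_add {r r' b p d : ℝ} (hσ : 0 ≤ σ) (hr : 0 ≤ r) (hb : 0 ≤ b)
    (hp : 0 ≤ p) (hd : 0 ≤ d)
    (h : r' ^ 2 ≤ r ^ 2 + 2 * σ * (b * (r' + r) + 2 * σ * (p ^ 2 + d ^ 2))) :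
    r' ≤ r + 2 * σ * (p + d + b) := by
  have hsquares : (r' - σ * b) ^ 2 ≤ (r + σ * b + 2 * σ * (p + d)) ^ 2 := by
    have hpd : 0 ≤ σ ^ 2 * (p * d) := by positivity
    have hcross : 0 ≤ σ * (p + d) * (r + σ * b) := by positivity
    nlinarith
  linarith [le_of_sq_le_sq hsquares (by positivity)]

lemma cAlpha_nonneg (α : ℝ) : 0 ≤ cAlpha α := Real.sqrt_nonneg _

lemma vAlpha_nonneg (m n : ℕ) (hα : 0 < α) (hα1 : α ≤ 1) : 0 ≤ vAlpha m n α :=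
  mul_nonneg (by positivity)
    (by linarith [log_window_add_four_le m n hα hα1, log_window_nonneg m n])

lemma sq_l2norm_sub_conv_le (hσ : 0 ≤ σ) (hS : ∀ u ∈ S, shift u ∈ S) (hxS : xS ∈ S)
    (hx : x = xS + ε) (hz : window m n z ∈ noiseEvent m n s B α (S.map (restr n)) ε)
    (hφ : φ ∈ feasible m ρ) (hφ' : IsConstrainedLS m n ρ (observe x σ z) φ') :
    l2norm n (x - conv φ' (observe x σ z)) ^ 2 ≤ l2norm n (x - conv φ (observe x σ z)) ^ 2
      + 2 * σ * ((√(2 * s) + cAlpha α) * (l2norm n (x - conv φ' (observe x σ z))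
        + l2norm n (x - conv φ (observe x σ z)))
        + (2 * (ρ * (B * cAlpha α)) + 2 * σ * (ρ * vAlpha m n α))) := by
  set y := observe x σ z with hy
  simp_rw [← norm_restr]
  set r := restr n (x - conv φ y)
  set r' := restr n (x - conv φ' y)
  have hresidual : ∀ ψ, restr n (y - conv ψ y) = restr n (x - conv ψ y) + (σ : ℂ) • restr n z :=
    fun ψ => by
      rw [← map_smul, ← map_add, hy, observe_eq_add_smul]
      congr 1
      abel
  have hls : ‖r' + (σ : ℂ) • restr n z‖ ≤ ‖r + (σ : ℂ) • restr n z‖ := by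
    rw [← hresidual, ← hresidual, norm_restr, norm_restr]
    exact le_of_sq_le_sq (hφ'.2 φ hφ) (Real.sqrt_nonneg _)
  have hsub : r - r' = restr n (filt m φ' y - filt m φ y) := by
    rw [← map_sub, conv_eq_filt hφ.1, conv_eq_filt hφ'.1.1, sub_sub_sub_cancel_left]
  have horthogonal : ‖inner ℂ ((S.map (restr n))ᗮ.starProjection (restr n z)) (r - r')‖
      ≤ 2 * (ρ * (B * cAlpha α)) + 2 * σ * (ρ * vAlpha m n α) := by
    rw [hsub, hy, hx]
    exact norm_inner_orthogonal_filt_observe_sub_le hσ hS hxS hz hφ hφ'.1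
  have hc := cAlpha_nonneg α
  calc ‖r'‖ ^ 2 ≤ ‖r‖ ^ 2 + 2 * ‖inner ℂ ((σ : ℂ) • restr n z) (r - r')‖ :=
        sq_norm_le_of_norm_add_le hls
    _ = ‖r‖ ^ 2 + 2 * σ * ‖inner ℂ (restr n z) (r - r')‖ := by
        rw [inner_smul_left, norm_mul, RCLike.norm_conj, Complex.norm_real,
          Real.norm_of_nonneg hσ, mul_assoc]
    _ ≤ _ := by
        gcongr
        refine (norm_inner_le_add_norm_inner_orthogonal hz.1.2 _).trans ?_
        gcongr
        exact (norm_sub_le r r').trans_eq (add_comm _ _)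

lemma l2norm_sub_conv_le (hρ : 0 ≤ ρ) (hσ : 0 ≤ σ) (hϰ : 0 ≤ ϰ) (hα : 0 < α) (hα1 : α ≤ 1)
    (hS : ∀ u ∈ S, shift u ∈ S) (hxS : xS ∈ S) (hx : x = xS + ε)
    (hz : window m n z ∈ noiseEvent m n s (σ * ϰ) α (S.map (restr n)) ε)
    (hφ : φ ∈ feasible m ρ) (hφ' : IsConstrainedLS m n ρ (observe x σ z) φ') :
    l2norm n (x - conv φ' (observe x σ z)) ≤ l2norm n (x - conv φ (observe x σ z))
      + 2 * σ * (√(ρ * vAlpha m n α) + √((ρ + 1) * cAlpha α * ϰ) + √(2 * s) + cAlpha α) := by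
  have hV := vAlpha_nonneg m n hα hα1
  have hc := cAlpha_nonneg α
  rw [add_assoc _ √(2 * s)]
  refine le_of_sq_le_add hσ (Real.sqrt_nonneg _) (by positivity) (Real.sqrt_nonneg _)
    (Real.sqrt_nonneg _) ((sq_l2norm_sub_conv_le hσ hS hxS hx hz hφ hφ').trans ?_)
  rw [Real.sq_sqrt (by positivity), Real.sq_sqrt (by positivity)]
  gcongr _ + 2 * σ * (_ + ?_)
  nlinarith [mul_nonneg hσ (mul_nonneg hc hϰ)]

end Deterministic

section AbsoluteConstants

variable {m n s : ℕ} {ρ ϰ α : ℝ}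

lemma sqrt_le_mul_sqrt {c x y : ℝ} (hc : 0 ≤ c) (h : x ≤ c ^ 2 * y) : √x ≤ c * √y :=
  (Real.sqrt_le_sqrt h).trans_eq (by rw [Real.sqrt_mul (sq_nonneg c), Real.sqrt_sq hc])

lemma log_two_div_nonneg (hα : 0 < α) (hα1 : α ≤ 1) : 0 ≤ Real.log (2 / α) :=
  Real.log_nonneg ((one_le_div hα).2 (by linarith))

lemma log_two_le_log_two_div (hα : 0 < α) (hα1 : α ≤ 1) : Real.log 2 ≤ Real.log (2 / α) :=
  Real.log_le_log two_pos (le_div_self zero_le_two hα hα1)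

lemma log_two_div_le (hα : 0 < α) (hm : 1 ≤ m) (hn : 1 ≤ n) :
    Real.log (2 / α) ≤ Real.log (((m : ℝ) + n) / α) := by
  refine Real.log_le_log (by positivity) ?_
  gcongr
  exact_mod_cast Nat.add_le_add hm hn

lemma vAlpha_le (hm : 1 ≤ m) (hn : 1 ≤ n) (hα : 0 < α) (hα1 : α ≤ 1) :
    vAlpha m n α ≤ 512 * ((1 + kappa m n ^ 2) * Real.log (((m : ℝ) + n) / α)) := by
  have hmn : (2 : ℝ) ≤ m + n := by exact_mod_cast Nat.add_le_add hm hn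
  have hℓ : Real.log 2 ≤ Real.log (((m : ℝ) + n) / α) :=
    (log_two_le_log_two_div hα hα1).trans (log_two_div_le hα hm hn)
  have hlog : Real.log (55 * ((m : ℝ) + n + 1) / α) ≤ 8 * Real.log (((m : ℝ) + n) / α) :=
    calc _ ≤ Real.log (2 ^ 7 * (((m : ℝ) + n) / α)) := by
          refine Real.log_le_log (by positivity) ?_
          rw [← mul_div_assoc]
          gcongr ?_ / α
          linarith
      _ = 7 * Real.log 2 + Real.log (((m : ℝ) + n) / α) := by
          rw [Real.log_mul (by norm_num) (by positivity), Real.log_pow, Nat.cast_ofNat]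
      _ ≤ _ := by linarith
  have hκ : (1 + 4 * kappa m n) ^ 2 ≤ 32 * (1 + kappa m n ^ 2) := by
    nlinarith [sq_nonneg (kappa m n - 1 / 4)]
  calc vAlpha m n α
      ≤ 2 * (1 + 4 * kappa m n) ^ 2 * (8 * Real.log (((m : ℝ) + n) / α)) := by
        rw [vAlpha]
        gcongr
    _ ≤ 2 * (32 * (1 + kappa m n ^ 2)) * (8 * Real.log (((m : ℝ) + n) / α)) := by
        have := (Real.log_pos one_lt_two).le.trans hℓ
        gcongr
    _ = _ := by ring

lemma cAlpha_le (hα : 0 < α) (hα1 : α ≤ 1) : cAlpha α ≤ 3 * √(Real.log (2 / α)) := by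
  refine sqrt_le_mul_sqrt (by norm_num) ?_
  rw [show (16 : ℝ) / α = 2 ^ 3 * (2 / α) by ring, Real.log_mul (by norm_num) (by positivity),
    Real.log_pow]
  push_cast
  linarith [log_two_le_log_two_div hα hα1, log_two_div_nonneg hα hα1]

lemma explicit_remainder_le_sqrt_r0Uniform (hm : 1 ≤ m) (hn : 1 ≤ n) (hρ : 1 ≤ ρ) (hϰ : 0 ≤ ϰ)
    (hα : 0 < α) (hα1 : α ≤ 1) :
    √(ρ * vAlpha m n α) + √((ρ + 1) * cAlpha α * ϰ) + √(2 * s) + cAlpha α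
      ≤ 50 * √(r0Uniform m n s ρ ϰ α) := by
  set r := r0Uniform m n s ρ ϰ α with hr
  set ℓ := Real.log (((m : ℝ) + n) / α)
  set q := Real.log (2 / α)
  have hq : 0 ≤ q := log_two_div_nonneg hα hα1
  have hqℓ : q ≤ ℓ := log_two_div_le hα hm hn
  have hℓ : 0 ≤ ℓ := hq.trans hqℓ
  have hquadratic : 0 ≤ ρ * (1 + kappa m n ^ 2) * ℓ := by positivity
  have hcorrelation : 0 ≤ ρ * ϰ * √q := by positivity
  have hs : (0 : ℝ) ≤ s := Nat.cast_nonneg s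
  rw [r0Uniform] at hr
  have hV : √(ρ * vAlpha m n α) ≤ 23 * √r := sqrt_le_mul_sqrt (by norm_num) <|
    calc ρ * vAlpha m n α ≤ ρ * (512 * ((1 + kappa m n ^ 2) * ℓ)) := by
          gcongr
          exact vAlpha_le hm hn hα hα1
      _ ≤ 23 ^ 2 * r := by linarith
  have hϰr : √((ρ + 1) * cAlpha α * ϰ) ≤ 3 * √r := sqrt_le_mul_sqrt (by norm_num) <|
    calc (ρ + 1) * cAlpha α * ϰ ≤ (2 * ρ) * (3 * √q) * ϰ := by
          have hc := cAlpha_nonneg α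
          gcongr
          · linarith
          · exact cAlpha_le hα hα1
      _ ≤ 3 ^ 2 * r := by linarith
  have hsr : √(2 * s) ≤ 2 * √r := sqrt_le_mul_sqrt (by norm_num) (by linarith)
  have hc : cAlpha α ≤ 3 * √r := (cAlpha_le hα hα1).trans <| by
    have hℓr : ℓ ≤ ρ * (1 + kappa m n ^ 2) * ℓ :=
      le_mul_of_one_le_left hℓ
        (one_le_mul_of_one_le_of_one_le hρ (le_add_of_nonneg_right (sq_nonneg (kappa m n))))
    gcongr
    linarith
  linarith [Real.sqrt_nonneg r]

lemma r0Uniform_le (hm : 1 ≤ m) (hmn : m ≤ n) (hρ : 0 ≤ ρ) (hϰ : 0 ≤ ϰ) (hα : 0 < α)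
    (hα2 : α ≤ 1 / 2) : r0Uniform m n s ρ ϰ α ≤ 2 ^ 2 * r0 m n s ρ ϰ α := by
  have hα1 : α ≤ 1 := hα2.trans (by norm_num)
  have hκ : 1 ≤ kappa m n ^ 2 := by
    rw [kappa, Real.sq_sqrt (by positivity), one_le_div (by positivity)]
    exact_mod_cast Nat.succ_le_succ hmn
  have hℓ : 0 ≤ Real.log (((m : ℝ) + n) / α) :=
    (log_two_div_nonneg hα hα1).trans (log_two_div_le hα hm (hm.trans hmn))
  have hlog : Real.log (2 / α) ≤ 2 ^ 2 * Real.log (1 / α) := by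
    have htwo : Real.log 2 ≤ Real.log (1 / α) :=
      Real.log_le_log two_pos ((le_div_iff₀ hα).2 (by linarith))
    rw [show (2 : ℝ) / α = 2 * (1 / α) by ring, Real.log_mul two_ne_zero (by positivity)]
    linarith [Real.log_pos one_lt_two]
  have hquadratic : ρ * (1 + kappa m n ^ 2) * Real.log (((m : ℝ) + n) / α)
      ≤ 4 * (ρ * kappa m n ^ 2 * Real.log (((m : ℝ) + n) / α)) :=
    calc _ ≤ ρ * (4 * kappa m n ^ 2) * Real.log (((m : ℝ) + n) / α) := by
          gcongr
          linarith
      _ = _ := by ring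
  have hcorrelation : ρ * ϰ * √(Real.log (2 / α)) ≤ 4 * (ρ * ϰ * √(Real.log (1 / α))) :=
    calc _ ≤ ρ * ϰ * (2 * √(Real.log (1 / α))) := by
          gcongr
          exact sqrt_le_mul_sqrt zero_le_two hlog
      _ ≤ _ := by nlinarith [show 0 ≤ ρ * ϰ * √(Real.log (1 / α)) by positivity]
  rw [r0Uniform, r0]
  linarith [(Nat.cast_nonneg s : (0 : ℝ) ≤ s)]

lemma explicit_remainder_le_sqrt_r0 (hm : 1 ≤ m) (hmn : m ≤ n) (hρ : 1 ≤ ρ) (hϰ : 0 ≤ ϰ)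
    (hα : 0 < α) (hα2 : α ≤ 1 / 2) :
    √(ρ * vAlpha m n α) + √((ρ + 1) * cAlpha α * ϰ) + √(2 * s) + cAlpha α
      ≤ 100 * √(r0 m n s ρ ϰ α) := by
  have hexplicit := explicit_remainder_le_sqrt_r0Uniform (s := s) hm (hm.trans hmn) hρ hϰ hα
    (hα2.trans (by norm_num))
  have hr0 := sqrt_le_mul_sqrt zero_le_two
    (r0Uniform_le (s := s) hm hmn (zero_le_one.trans hρ) hϰ hα hα2)
  linarith

end AbsoluteConstants

section Probability

variable {Ω : Type*} [MeasurableSpace Ω] {μ : Measure Ω} {m n : ℕ} {ζ : ℤ → Ω → ℂ}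

lemma measurable_window (m n : ℕ) : Measurable (window m n) :=
  (WithLp.measurable_toLp 2 _).comp (measurable_pi_lambda _ fun t => measurable_pi_apply (t : ℤ))

lemma IsComplexWhiteNoise.measure_window_mem [IsProbabilityMeasure μ]
    (hζ : IsComplexWhiteNoise μ (Set.Icc (-(m : ℤ)) n) ζ) {G : Set (WindowSpace m n)}
    (hG : MeasurableSet G) :
    μ {ω | window m n (fun t => ζ t ω) ∈ G} = stdGaussian (WindowSpace m n) G := by
  have hmeas : Measurable fun ω => window m n (fun t => ζ t ω) :=
    (WithLp.measurable_toLp 2 _).comp (measurable_pi_lambda _ fun t => hζ.measurable t t.2)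
  rw [← hζ.map_eq_stdGaussian]
  exact (Measure.map_apply hmeas hG).symm

end Probability

end FilterLS

end

theorem theorem1 : ∃ C : ℝ, 0 < C ∧
    ∀ {Ω : Type*} [MeasurableSpace Ω] (μ : Measure Ω) [IsProbabilityMeasure μ]
      (m n s : ℕ) (ρ σ ϰ α : ℝ) (x φ : ℤ → ℂ) (ζ : ℤ → Ω → ℂ),
      1 ≤ ρ → 0 ≤ σ → 0 ≤ ϰ → 0 < α → α ≤ 1 →
      FilterLS.IsComplexWhiteNoise μ (Set.Icc (-(m : ℤ)) n) ζ →
      FilterLS.NearShiftInvariant m n s σ ϰ x →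
      φ ∈ FilterLS.feasible m ρ →
      ∃ Ξ : Set (ℤ → ℂ), MeasurableSet Ξ ∧
        ENNReal.ofReal (1 - α) ≤ μ {ω | (fun t => ζ t ω) ∈ Ξ} ∧
        ∀ z ∈ Ξ, ∀ φhat : ℤ → ℂ,
          FilterLS.IsConstrainedLS m n ρ (FilterLS.observe x σ z) φhat →
          -- the bound with explicit constants
          (FilterLS.l2norm n (x - FilterLS.conv φhat (FilterLS.observe x σ z)) ≤
            FilterLS.l2norm n (x - FilterLS.conv φ (FilterLS.observe x σ z)) +
              2 * σ * (Real.sqrt (ρ * FilterLS.vAlpha m n α)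
                + Real.sqrt ((ρ + 1) * FilterLS.cAlpha α * ϰ)
                + Real.sqrt (2 * s) + FilterLS.cAlpha α)) ∧
          -- the bound with an absolute constant, uniform in all bandwidths and levels
          (1 ≤ m → 1 ≤ n →
            FilterLS.l2norm n (x - FilterLS.conv φhat (FilterLS.observe x σ z)) ≤
              FilterLS.l2norm n (x - FilterLS.conv φ (FilterLS.observe x σ z)) +
                C * σ * Real.sqrt (FilterLS.r0Uniform m n s ρ ϰ α)) ∧
          -- its simplified form for bandwidths at most `n` and levels at most `1/2`
          (1 ≤ m → m ≤ n → α ≤ 1 / 2 →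
            FilterLS.l2norm n (x - FilterLS.conv φhat (FilterLS.observe x σ z)) ≤
              FilterLS.l2norm n (x - FilterLS.conv φ (FilterLS.observe x σ z)) +
                C * σ * Real.sqrt (FilterLS.r0 m n s ρ ϰ α)) := by
  refine ⟨200, by norm_num, ?_⟩
  intro Ω _ μ _ m n s ρ σ ϰ α x φ ζ hρ hσ hϰ hα hα1 hζ ⟨hs, _, S, hdim, hS, xS, hxS, ε, hx, hε⟩ hφ
  have hfin : Module.Finite ℂ S := Module.finite_of_finrank_pos (by omega)
  have hW : Module.finrank ℂ (S.map (FilterLS.restr n)) ≤ s :=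
    hdim ▸ Submodule.finrank_map_le (FilterLS.restr n) S
  have hΞ := FilterLS.measurableSet_noiseEvent (m := m) (s := s) (B := σ * ϰ) (α := α)
    (W := S.map (FilterLS.restr n)) (ε := ε)
  refine ⟨_, FilterLS.measurable_window m n hΞ, ?_, fun z hz φhat hhat => ?_⟩
  · exact (FilterLS.ofReal_one_sub_le_stdGaussian_noiseEvent hα hα1 hs hW (mul_nonneg hσ hϰ)
      hε).trans_eq (hζ.measure_window_mem hΞ).symm
  have hexplicit := FilterLS.l2norm_sub_conv_le (zero_le_one.trans hρ) hσ hϰ hα hα1 hS hxS hx hz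
    hφ hhat
  have hscale : ∀ {a r : ℝ}, a ≤ 100 * r → 2 * σ * a ≤ 200 * σ * r := fun h => by
    linarith [mul_le_mul_of_nonneg_left h hσ]
  refine ⟨hexplicit, fun hm hn => hexplicit.trans ?_, fun hm hmn hα2 => hexplicit.trans ?_⟩
  · refine add_le_add_right (hscale ?_) _
    exact (FilterLS.explicit_remainder_le_sqrt_r0Uniform hm hn hρ hϰ hα hα1).trans
      (by gcongr; norm_num)
  · exact add_le_add_right
      (hscale (FilterLS.explicit_remainder_le_sqrt_r0 hm hmn hρ hϰ hα hα2)) _
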